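/- Let $\|f\|$ denote the essential supremum of $|f|$ over $\mathbb{R}$. For an integer $r\ge 1$ let $L^r_{\infty,\infty}(\mathbb{R})$ be the set of essentially bounded functions $x:\mathbb{R}\to\mathbb{R}$ such that $x^{(r-1)}$ exists everywhere and is locally absolutely continuous (where $x^{(0)}=x$) and $x^{(r)}$, which then exists almost everywhere, is essentially bounded. For $a_1,a_2\ge 0$ put $T=a_1+a_2+2$. Let $\psi_1(a_1,a_2;\cdot)$ be the $2T$-periodic function given on $[0,T]$ by $$\psi_1(a_1,a_2;t)=\begin{cases}0,& t\in[0,a_1],\\ t-a_1,& t\in[a_1,a_1+1],\\ 1,& t\in[a_1+1,a_1+a_2+1],\\ 2+a_1+a_2-t,& t\in[a_1+a_2+1,T],\end{cases}$$ and on $[T,2T]$ by $\psi_1(a_1,a_2;t)=-\psi_1(a_1,a_2;t-T)$. For $r\ge 2$ let $\psi_r(a_1,a_2;\cdot)$ be the $2T$-periodic primitive of $\psi_{r-1}(a_1,a_2;\cdot)$ with zero mean over the period. For $r\ge 1$, $\lambda>0$, $b\in\mathbb{R}$ set $$\Psi(t)=\Psi_{r;a_1,a_2,b,\lambda}(t)=b\left(\frac{\lambda}{2a_1+2a_2+4}\right)^{r}\psi_r\left(a_1,a_2;\frac{2a_1+2a_2+4}{\lambda}\,t\right).$$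 **Theorem.** Let $r\ge 1$ be an integer, $x\in L^r_{\infty,\infty}(\mathbb{R})$, $a_1,a_2\ge 0$, $\lambda>0$, $b\ne 0$, $\Psi=\Psi_{r;a_1,a_2,b,\lambda}$, and suppose that at least one of the following conditions holds: (a) $a_1=0$ and $\|x^{(k)}\|\le\|\Psi^{(k)}\|$ for $k\in\{0,r-1,r\}$; (b) $r\ge 2$, $a_2=0$ and $\|x^{(k)}\|\le\|\Psi^{(k)}\|$ for $k\in\{0,r-2,r\}$; (c) $r\ge 2$ and $\|x^{(k)}\|\le\|\Psi^{(k)}\|$ for $k\in\{0,r-2,r-1,r\}$. If $\tau,\xi\in\mathbb{R}$ are such that $x(\tau)=\Psi(\xi)$, then $$|x'(\tau)|\le|\Psi'(\xi)|.$$ (If $r\ge 2$, both derivatives exist everywhere. If $r=1$, they may fail to exist at some points; there the value $0$ is assigned to the derivative that does not exist.) -/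

import Mathlib

open MeasureTheory
open scoped ENNReal

namespace RodovComparison

noncomputable section

/-- The essential-supremum norm `‖f‖ = ess sup |f|` over the whole real line,
with values in `[0, ∞]`. -/
def supNorm (f : ℝ → ℝ) : ℝ≥0∞ :=
  eLpNorm f ∞ volume

/-- The space `L^r_{∞,∞}(ℝ)`, `r ≥ 1`: functions that are measurable and essentially bounded,
whose derivative of order `r - 1` exists everywhere and is locally absolutely continuous, and
whose derivative of order `r` (which then exists almost everywhere) is essentially bounded. -/
structure MemLInfInf (r : ℕ) (x : ℝ → ℝ) : Prop where
  contDiff : ContDiff ℝ ((r - 1 : ℕ) : WithTop ℕ∞) x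
  locallyAC : ∀ u v : ℝ, AbsolutelyContinuousOnInterval (iteratedDeriv (r - 1) x) u v
  memLp_deriv : MemLp (iteratedDeriv r x) ∞ volume
  memLp : MemLp x ∞ volume

/-- The trapezoid on `[0, T]`, `T = a₁ + a₂ + 2`. -/
def trapezoid (a₁ a₂ t : ℝ) : ℝ :=
  if t ≤ a₁ then 0
  else if t ≤ a₁ + 1 then t - a₁
  else if t ≤ a₁ + a₂ + 1 then 1
  else 2 + a₁ + a₂ - t

/-- The half-period `T = a₁ + a₂ + 2`. -/
def halfPeriod (a₁ a₂ : ℝ) : ℝ :=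
  a₁ + a₂ + 2

/-- One full period, on `[0, 2T]`: the trapezoid on `[0, T]` and minus its translate
on `[T, 2T]`. -/
def onePeriod (a₁ a₂ t : ℝ) : ℝ :=
  if t ≤ halfPeriod a₁ a₂ then trapezoid a₁ a₂ t
  else -trapezoid a₁ a₂ (t - halfPeriod a₁ a₂)

/-- `ψ₁(a₁, a₂; ·)`: the `2T`-periodic extension of `onePeriod` to the real line.
The number `2T * fract (t / 2T)` is the representative of `t` modulo `2T` in `[0, 2T)`. -/
def psiOne (a₁ a₂ t : ℝ) : ℝ :=
  onePeriod a₁ a₂ (2 * halfPeriod a₁ a₂ * Int.fract (t / (2 * halfPeriod a₁ a₂)))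

/-- The primitive of `f` that has zero mean over `[0, p]`. It is `p`-periodic when `f` is
`p`-periodic with zero mean over a period. -/
def zeroMeanPrimitive (p : ℝ) (f : ℝ → ℝ) (t : ℝ) : ℝ :=
  (∫ s in (0 : ℝ)..t, f s) - p⁻¹ * ∫ u in (0 : ℝ)..p, ∫ s in (0 : ℝ)..u, f s

/-- `ψ_r(a₁, a₂; ·)`, `r ≥ 1`: the `(r - 1)`-th `2T`-periodic integral of `ψ₁(a₁, a₂; ·)` with
zero mean over the period. -/
def psi (r : ℕ) (a₁ a₂ : ℝ) : ℝ → ℝ :=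
  (zeroMeanPrimitive (2 * halfPeriod a₁ a₂))^[r - 1] (psiOne a₁ a₂)

/-- The comparison spline `Ψ_{r; a₁, a₂, b, l}`, which is `l`-periodic. -/
def comparisonSpline (r : ℕ) (a₁ a₂ b l t : ℝ) : ℝ :=
  b * (l / (2 * a₁ + 2 * a₂ + 4)) ^ r * psi r a₁ a₂ ((2 * a₁ + 2 * a₂ + 4) / l * t)

/-- `‖x^{(k)}‖ ≤ ‖y^{(k)}‖`, where derivatives may exist only almost everywhere. -/
def DerivNormLE (k : ℕ) (x y : ℝ → ℝ) : Prop :=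
  supNorm (iteratedDeriv k x) ≤ supNorm (iteratedDeriv k y)

end

end RodovComparison

/-!
The theorem is a comparison theorem of Kolmogorov's type, and is proved by counting sign changes.

After scaling, `Ψ` is `ψ_r` itself, and the hypotheses become pointwise bounds for `x` and some of
its derivatives, together with a Lipschitz bound for `x^{(r-1)}`. Suppose that `x(τ) = ψ_r(ξ)` and
`|x'(τ)| > |ψ_r'(ξ)|`. After a translation, a reflection and a change of sign, `ξ` lies in a
half-period in which `ψ_r` goes from its minimum to its maximum, and `x' > ψ_r'` at the crossing.
In this half-period `x - ψ_r` then changes sign three times, while the bound on `x` alone forces one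
sign change in each of the other half-periods. These sign changes are stable under small
perturbations. The function `x` can therefore be multiplied by a wide plateau function, continued
periodically with period `2Tm`, where `T` is the half-period, and multiplied by a constant slightly
below `1`, without leaving the bounds (`BoundedTower.exists_periodic`). This uses that the
intermediate derivatives of `x` are bounded (`exists_bound_of_lipschitz`). The difference now has
`2m + 2` sign changes in each period, and by Rolle's theorem so have, on average, its derivatives
(`Alternating.iterate_deriv`).

On the other hand, the difference of the derivatives of order `r - 1` or `r - 2` changes sign at
most once in each half-period, in alternating directions, so at most `2m` times in a period
(`Alternating.le_div_add_two`). For the order `r - 1` and `a₁ = 0` the wave `ψ₁` has slope `±1`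
wherever it is not `±1`, and a function with Lipschitz constant `1` crosses it in one direction only
(`block_psiOne`). For the order `r - 2` the difference with `ψ₂` is concave, decreasing and convex
on successive parts of a half-period, with known signs at its ends (`block_psi_two`). The
contradiction is `ComparisonTower.not_crossing`. For `r = 1` the derivative may fail to exist and
the comparison is direct (`abs_deriv_le_psiOne`).
-/

namespace RodovComparison

/-! ### Functions with bounded derivatives -/

/-- A function `Y 0` together with its derivatives `Y 1, …, Y n`, where `|Y k| ≤ B k` for `k ≤ n`
and `Y n` is Lipschitz with constant `B (n + 1)`. The values `Y k` for `k > n` are irrelevant. -/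
structure BoundedTower (n : ℕ) (B : ℕ → ℝ) (Y : ℕ → ℝ → ℝ) : Prop where
  hasDerivAt : ∀ k < n, ∀ t, HasDerivAt (Y k) (Y (k + 1) t) t
  bound : ∀ k ≤ n, ∀ t, |Y k t| ≤ B k
  lip : ∀ u v, |Y n u - Y n v| ≤ B (n + 1) * |u - v|

theorem abs_sub_le_of_hasDerivAt {f f' : ℝ → ℝ} {C : ℝ} (hf : ∀ t, HasDerivAt f (f' t) t)
    (hC : ∀ t, |f' t| ≤ C) (u v : ℝ) : |f u - f v| ≤ C * |u - v| := by
  have := Convex.norm_image_sub_le_of_norm_hasDerivWithin_le (f := f) (f' := f') (s := Set.univ)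
    (x := v) (y := u) (C := C) (fun t _ => (hf t).hasDerivWithinAt) (fun t _ => hC t) convex_univ
    (Set.mem_univ _) (Set.mem_univ _)
  simpa using this

namespace BoundedTower

variable {n : ℕ} {B : ℕ → ℝ} {Y : ℕ → ℝ → ℝ}

theorem lipschitz (h : BoundedTower n B Y) {k : ℕ} (hk : k ≤ n) (u v : ℝ) :
    |Y k u - Y k v| ≤ B (k + 1) * |u - v| := by
  rcases hk.lt_or_eq with hk | rfl
  · exact abs_sub_le_of_hasDerivAt (h.hasDerivAt k hk) (h.bound (k + 1) hk) u v
  · exact h.lip u v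

theorem neg (h : BoundedTower n B Y) : BoundedTower n B (fun k t => -Y k t) where
  hasDerivAt k hk t := (h.hasDerivAt k hk t).neg
  bound k hk t := by simpa using h.bound k hk t
  lip u v := by
    rw [neg_sub_neg, abs_sub_comm]
    exact h.lip u v

theorem translate (h : BoundedTower n B Y) (c : ℝ) : BoundedTower n B (fun k t => Y k (t + c)) where
  hasDerivAt k hk t := (h.hasDerivAt k hk (t + c)).comp_add_const t c
  bound k hk t := h.bound k hk _
  lip u v := by simpa using h.lip (u + c) (v + c)

theorem reflect (h : BoundedTower n B Y) :
    BoundedTower n B (fun k t => (-1) ^ k * Y k (-t)) where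
  hasDerivAt k hk t := by
    have h1 := ((h.hasDerivAt k hk (-t)).comp t (hasDerivAt_neg t)).const_mul ((-1 : ℝ) ^ k)
    refine h1.congr_deriv ?_
    ring
  bound k hk t := by simpa [abs_mul] using h.bound k hk (-t)
  lip u v := by
    have := h.lip (-u) (-v)
    rw [← mul_sub, abs_mul, abs_pow, abs_neg, abs_one, one_pow, one_mul]
    refine this.trans_eq ?_
    rw [← abs_neg (-u - -v)]
    congr 2
    ring

theorem const_mul (h : BoundedTower n B Y) {c : ℝ} (hc : 0 ≤ c) :
    BoundedTower n (fun k => c * B k) (fun k t => c * Y k t) where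
  hasDerivAt k hk t := (h.hasDerivAt k hk t).const_mul c
  bound k hk t := by
    rw [abs_mul, abs_of_nonneg hc]
    exact mul_le_mul_of_nonneg_left (h.bound k hk t) hc
  lip u v := by
    rw [← mul_sub, abs_mul, abs_of_nonneg hc, mul_assoc]
    exact mul_le_mul_of_nonneg_left (h.lip u v) hc

theorem mono (h : BoundedTower n B Y) {B' : ℕ → ℝ} (hB : ∀ k ≤ n + 1, B k ≤ B' k) :
    BoundedTower n B' Y where
  hasDerivAt := h.hasDerivAt
  bound k hk t := (h.bound k hk t).trans (hB k (by omega))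
  lip u v := (h.lip u v).trans (mul_le_mul_of_nonneg_right (hB _ le_rfl) (abs_nonneg _))

end BoundedTower

/-! ### Boundedness of the intermediate derivatives -/

/-- A bounded function has points with a bounded `k`-th derivative in every interval of length `k`,
because a `k`-th difference with step `1` is a value of the `k`-th derivative. -/
theorem exists_abs_le_of_bounded (k : ℕ) : ∀ (X : ℕ → ℝ → ℝ) (M : ℝ),
    (∀ i < k, ∀ t, HasDerivAt (X i) (X (i + 1) t) t) → (∀ t, |X 0 t| ≤ M) →
    ∀ t : ℝ, ∃ θ : ℝ, t ≤ θ ∧ θ ≤ t + k ∧ |X k θ| ≤ 2 ^ k * M := by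
  induction k with
  | zero => intro X M _ h0 t; exact ⟨t, le_rfl, by simp, by simpa using h0 t⟩
  | succ k ih =>
    intro X M hX h0 t
    obtain ⟨θ, h1, h2, h3⟩ := ih (fun i t => X i (t + 1) - X i t) (2 * M)
      (fun i hi t => ((hX i (by omega) (t + 1)).comp_add_const t 1).sub (hX i (by omega) t))
      (fun t => by
        have := abs_sub (X 0 (t + 1)) (X 0 t)
        linarith [h0 t, h0 (t + 1)]) t
    obtain ⟨c, hc, hc'⟩ := exists_hasDerivAt_eq_slope (X k) (X (k + 1)) (lt_add_one θ)
      (fun y _ => (hX k (by omega) y).continuousAt.continuousWithinAt)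
      (fun y _ => hX k (by omega) y)
    refine ⟨c, by linarith [hc.1], ?_, ?_⟩
    · push_cast
      linarith [hc.2]
    · rw [hc', add_sub_cancel_left, div_one, pow_succ, mul_assoc]
      exact h3

/-- If a function is bounded and its `n`-th derivative is Lipschitz, all derivatives up to order `n`
are bounded: each is Lipschitz, hence close to its value at some point where it is bounded. -/
theorem exists_bound_of_lipschitz {n : ℕ} {X : ℕ → ℝ → ℝ} {M L : ℝ}
    (hX : ∀ i < n, ∀ t, HasDerivAt (X i) (X (i + 1) t) t) (h0 : ∀ t, |X 0 t| ≤ M)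
    (hL : ∀ u v, |X n u - X n v| ≤ L * |u - v|) {k : ℕ} (hk : k ≤ n) :
    ∃ b, ∀ t, |X k t| ≤ b := by
  have key : ∀ k ≤ n, ∀ C, (∀ u v, |X k u - X k v| ≤ C * |u - v|) → ∃ b, ∀ t, |X k t| ≤ b := by
    intro k hk C hC
    refine ⟨2 ^ k * M + |C| * k, fun t => ?_⟩
    obtain ⟨θ, h1, h2, h3⟩ := exists_abs_le_of_bounded k X M (fun i hi => hX i (by omega)) h0 t
    have h4 := hC t θ
    have h5 : C * |t - θ| ≤ |C| * k := by
      refine mul_le_mul (le_abs_self C) ?_ (abs_nonneg _) (abs_nonneg _)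
      rw [abs_le]; constructor <;> linarith
    have h6 := abs_sub_abs_le_abs_sub (X k t) (X k θ)
    linarith
  obtain ⟨j, rfl⟩ : ∃ j, n = k + j := ⟨n - k, by omega⟩
  induction j generalizing k with
  | zero => exact key k le_rfl L hL
  | succ j ih =>
    have e : k + (j + 1) = k + 1 + j := by omega
    obtain ⟨b, hb⟩ := @ih (k + 1) (by rw [← e]; exact hX) (by rw [← e]; exact hL)
      (by omega) (by rw [← e]; exact key)
    exact key k hk b fun u v => abs_sub_le_of_hasDerivAt (hX k (by omega)) hb u v

/-! ### Cutting off -/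

/-- The `k`-th derivative of the product of two towers, by the Leibniz rule. -/
def leibniz (X H : ℕ → ℝ → ℝ) (k : ℕ) (t : ℝ) : ℝ :=
  ∑ i ∈ Finset.range (k + 1), (k.choose i : ℝ) * (X i t * H (k - i) t)

theorem hasDerivAt_leibniz {X H : ℕ → ℝ → ℝ} {k : ℕ} {t : ℝ}
    (hX : ∀ i ≤ k, HasDerivAt (X i) (X (i + 1) t) t)
    (hH : ∀ i, HasDerivAt (H i) (H (i + 1) t) t) :
    HasDerivAt (leibniz X H k) (leibniz X H (k + 1) t) t := by
  have h1 : HasDerivAt (leibniz X H k) (∑ i ∈ Finset.range (k + 1), (k.choose i : ℝ) *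
      (X (i + 1) t * H (k - i) t + X i t * H (k - i + 1) t)) t := by
    unfold leibniz
    refine HasDerivAt.fun_sum fun i hi => ?_
    exact ((hX i (by simpa [Nat.lt_succ_iff] using hi)).mul (hH (k - i))).const_mul _
  convert h1 using 1
  rw [leibniz, Finset.sum_choose_succ_mul (fun i j => X i t * H j t) k, ← Finset.sum_add_distrib]
  refine Finset.sum_congr rfl fun i hi => ?_
  have : i ≤ k := by simpa [Nat.lt_succ_iff] using hi
  rw [Nat.sub_add_comm this]
  ring

/-- A smooth plateau function `H 0`, its derivatives `H j`, and bounds `E j` for them. -/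
theorem exists_plateau : ∃ (H : ℕ → ℝ → ℝ) (E : ℕ → ℝ),
    (∀ j t, HasDerivAt (H j) (H (j + 1) t) t) ∧ (∀ j t, |H j t| ≤ E j) ∧ E 0 = 1 ∧
    (∀ t, |t| ≤ 1 → H 0 t = 1) ∧ ∀ j t, 2 < |t| → H j t = 0 := by
  let η : ContDiffBump (0 : ℝ) := ⟨1, 2, one_pos, one_lt_two⟩
  have hη : ContDiff ℝ (⊤ : ℕ∞) η := η.contDiff
  have hd : ∀ j t, HasDerivAt (iteratedDeriv j η) (iteratedDeriv (j + 1) η t) t := by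
    intro j t
    rw [iteratedDeriv_succ]
    exact ((hη.differentiable_iteratedDeriv j (by exact_mod_cast ENat.natCast_lt_top j)) t).hasDerivAt
  have h0 : ∀ j t, 2 < |t| → iteratedDeriv j η t = 0 := by
    intro j t ht
    have : η =ᶠ[nhds t] fun _ => (0 : ℝ) := by
      filter_upwards [(isOpen_lt continuous_const continuous_abs).mem_nhds ht] with s hs
      exact η.zero_of_le_dist (by simpa using hs.le)
    rw [this.iteratedDeriv_eq]
    simp
  have hb : ∀ j, ∃ C, ∀ t, |iteratedDeriv j η t| ≤ C := by
    intro j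
    obtain ⟨C, hC⟩ := isCompact_Icc.exists_bound_of_continuousOn (s := Set.Icc (-2 : ℝ) 2)
      (f := iteratedDeriv j η) fun t _ => (hd j t).continuousAt.continuousWithinAt
    refine ⟨max C 0, fun t => ?_⟩
    by_cases ht : 2 < |t|
    · simp [h0 j t ht]
    · exact (hC t (abs_le.1 (not_lt.1 ht))).trans (le_max_left _ _)
  choose C hC using hb
  refine ⟨fun j => iteratedDeriv j η, fun j => if j = 0 then 1 else C j, hd, ?_, by simp, ?_, h0⟩
  · intro j t
    rcases Nat.eq_zero_or_pos j with rfl | hj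
    · simp only [iteratedDeriv_zero, if_true]
      rw [abs_of_nonneg η.nonneg]
      exact η.le_one
    · simpa [hj.ne'] using hC j t
  · intro t ht
    simp only [iteratedDeriv_zero]
    exact η.one_of_mem_closedBall (by simpa using ht)

theorem abs_mul_sub_mul_le {a b a' b' A B' p q d : ℝ} (ha : |a| ≤ A) (hb : |b'| ≤ B')
    (h1 : |a - a'| ≤ p * d) (h2 : |b - b'| ≤ q * d) :
    |a * b - a' * b'| ≤ (p * B' + A * q) * d := by
  have e : a * b - a' * b' = a * (b - b') + (a - a') * b' := by ring
  rw [e]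
  refine (abs_add_le _ _).trans ?_
  rw [abs_mul, abs_mul]
  have := mul_le_mul ha h2 (abs_nonneg _) ((abs_nonneg _).trans ha)
  have := mul_le_mul h1 hb (abs_nonneg _) ((abs_nonneg _).trans h1)
  nlinarith

/-- Multiplying by a wide plateau increases the bounds by an arbitrarily small factor. -/
theorem BoundedTower.exists_cutoff {n : ℕ} {B : ℕ → ℝ} {X : ℕ → ℝ → ℝ} (h : BoundedTower n B X)
    (hB : ∀ k ≤ n + 1, 0 < B k) {θ : ℝ} (hθ : 1 < θ) :
    ∃ N₀ : ℝ, ∀ N, N₀ ≤ N → ∃ G : ℕ → ℝ → ℝ, BoundedTower n (fun k => θ * B k) G ∧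
      (∀ t, |t| ≤ N → G 0 t = X 0 t) ∧ ∀ k t, 2 * N < |t| → G k t = 0 := by
  obtain ⟨H, E, hH, hE, hE0, hone, hzero⟩ := exists_plateau
  -- The bounds that the Leibniz rule gives, as polynomials in the inverse width `ε`.
  let p : ℕ → ℝ → ℝ := fun k ε => ∑ i ∈ Finset.range (k + 1),
    (k.choose i : ℝ) * (B i * (ε ^ (k - i) * E (k - i)))
  let q : ℝ → ℝ := fun ε => ∑ i ∈ Finset.range (n + 1), (n.choose i : ℝ) *
    (B (i + 1) * (ε ^ (n - i) * E (n - i)) + B i * (ε ^ (n - i + 1) * E (n - i + 1)))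
  -- Only the term without derivatives of the plateau survives at `ε = 0`.
  have hp0 : ∀ k, p k 0 = B k := by
    intro k
    simp only [p]
    rw [Finset.sum_eq_single k]
    · simp [hE0]
    · intro i hi hik
      have : k - i ≠ 0 := by simp at hi; omega
      simp [this]
    · simp
  have hq0 : q 0 = B (n + 1) := by
    simp only [q]
    rw [Finset.sum_eq_single n]
    · simp [hE0]
    · intro i hi hik
      have : n - i ≠ 0 := by simp at hi; omega
      simp [this]
    · simp
  have hpc : ∀ k, Continuous (p k) := fun k => by simp only [p]; fun_prop
  have hqc : Continuous q := by simp only [q]; fun_prop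
  have ev : ∀ᶠ ε in nhds (0 : ℝ), (∀ k ∈ Finset.range (n + 1), p k ε < θ * B k) ∧
      q ε < θ * B (n + 1) := by
    refine Filter.Eventually.and ?_ ?_
    · refine (Finset.eventually_all _).2 fun k hk => ?_
      refine (hpc k).continuousAt.eventually_lt_const ?_
      rw [hp0]
      have := hB k (by simp at hk; omega)
      nlinarith
    · refine hqc.continuousAt.eventually_lt_const ?_
      rw [hq0]
      have := hB (n + 1) le_rfl
      nlinarith
  have ev2 := tendsto_inv_atTop_zero.eventually ev
  obtain ⟨N₁, hN₁⟩ := Filter.eventually_atTop.1 ev2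
  refine ⟨max N₁ 1, fun N hN => ?_⟩
  have hNpos : 0 < N := lt_of_lt_of_le one_pos ((le_max_right _ _).trans hN)
  obtain ⟨hpN, hqN⟩ := hN₁ N ((le_max_left _ _).trans hN)
  set ε := N⁻¹ with hε
  have hεpos : 0 < ε := inv_pos.2 hNpos
  let K : ℕ → ℝ → ℝ := fun j t => ε ^ j * H j (ε * t)
  have hK : ∀ j t, HasDerivAt (K j) (K (j + 1) t) t := by
    intro j t
    have h1 := ((hH j (ε * t)).comp t ((hasDerivAt_id t).const_mul ε)).const_mul (ε ^ j)
    refine h1.congr_deriv ?_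
    simp only [K]
    ring
  have hKb : ∀ j t, |K j t| ≤ ε ^ j * E j := by
    intro j t
    simp only [K]
    rw [abs_mul, abs_of_pos (pow_pos hεpos j)]
    exact mul_le_mul_of_nonneg_left (hE _ _) (pow_pos hεpos j).le
  refine ⟨leibniz X K, ⟨?_, ?_, ?_⟩, ?_, ?_⟩
  · intro k hk t
    exact hasDerivAt_leibniz (fun i hi => h.hasDerivAt i (by omega) t) (fun i => hK i t)
  · intro k hk t
    refine le_trans ?_ (hpN k (by simp; omega)).le
    refine (Finset.abs_sum_le_sum_abs _ _).trans (Finset.sum_le_sum fun i hi => ?_)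
    have hi' : i ≤ k := by simpa [Nat.lt_succ_iff] using hi
    rw [abs_mul, Nat.abs_cast, abs_mul]
    refine mul_le_mul_of_nonneg_left ?_ (Nat.cast_nonneg _)
    exact mul_le_mul (h.bound i (by omega) t) (hKb _ t) (abs_nonneg _) (hB i (by omega)).le
  · intro u v
    refine le_trans ?_ (mul_le_mul_of_nonneg_right hqN.le (abs_nonneg _))
    unfold leibniz
    rw [← Finset.sum_sub_distrib, Finset.sum_mul]
    refine (Finset.abs_sum_le_sum_abs _ _).trans (Finset.sum_le_sum fun i hi => ?_)
    have hi' : i ≤ n := by simpa [Nat.lt_succ_iff] using hi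
    rw [← mul_sub, abs_mul, Nat.abs_cast, mul_assoc]
    refine mul_le_mul_of_nonneg_left ?_ (Nat.cast_nonneg _)
    exact abs_mul_sub_mul_le (h.bound i hi' u) (hKb _ v) (h.lipschitz hi' u v)
      (abs_sub_le_of_hasDerivAt (hK _) (hKb _) u v)
  · intro t ht
    have : H 0 (ε * t) = 1 := by
      refine hone _ ?_
      rw [abs_mul, abs_of_pos hεpos, hε, inv_mul_le_iff₀ hNpos, mul_one]
      exact ht
    simp [leibniz, K, this]
  · intro k t ht
    refine Finset.sum_eq_zero fun i _ => ?_
    have : H (k - i) (ε * t) = 0 := by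
      refine hzero _ _ ?_
      rw [abs_mul, abs_of_pos hεpos, hε, lt_inv_mul_iff₀ hNpos]
      linarith
    simp [K, this]

/-! ### Periodization -/

/-- A function that vanishes at the points of a progression is Lipschitz as soon as it is so
between neighbouring points. -/
theorem lipschitz_of_lipschitz_on_blocks {f : ℝ → ℝ} {a P L : ℝ} (hP : 0 < P) (hL : 0 ≤ L)
    (h0 : ∀ j : ℤ, f (a + j * P) = 0)
    (hf : ∀ j : ℤ, ∀ u v, a + j * P ≤ u → u ≤ a + (j + 1) * P → a + j * P ≤ v →
      v ≤ a + (j + 1) * P → |f u - f v| ≤ L * |u - v|) (u v : ℝ) :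
    |f u - f v| ≤ L * |u - v| := by
  wlog huv : u ≤ v generalizing u v
  · rw [abs_sub_comm, abs_sub_comm u]
    exact this v u (le_of_not_ge huv)
  have hfl : ∀ w, a + ⌊(w - a) / P⌋ * P ≤ w ∧ w ≤ a + (⌊(w - a) / P⌋ + 1) * P := by
    intro w
    have h1 := Int.floor_le ((w - a) / P)
    have h2 := (Int.lt_floor_add_one ((w - a) / P)).le
    rw [le_div_iff₀ hP] at h1
    rw [div_le_iff₀ hP] at h2
    constructor <;> linarith
  obtain ⟨u1, u2⟩ := hfl u
  obtain ⟨v1, v2⟩ := hfl v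
  have hij : ⌊(u - a) / P⌋ ≤ ⌊(v - a) / P⌋ := by gcongr
  set i := ⌊(u - a) / P⌋
  set j := ⌊(v - a) / P⌋
  rcases hij.lt_or_eq with hij | hij
  · have h1 := hf i u (a + (i + 1) * P) u1 u2 (by nlinarith) le_rfl
    have h2 := hf j (a + j * P) v le_rfl (by nlinarith) v1 v2
    have z1 := h0 (i + 1)
    push_cast at z1
    rw [z1, sub_zero] at h1
    rw [h0, zero_sub, abs_neg] at h2
    have h3 : ((i : ℝ) + 1) * P ≤ j * P := by
      have : ((i + 1 : ℤ) : ℝ) ≤ j := by exact_mod_cast hij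
      push_cast at this
      exact mul_le_mul_of_nonneg_right this hP.le
    rw [abs_of_nonpos (sub_nonpos.2 u2)] at h1
    rw [abs_of_nonpos (sub_nonpos.2 v1)] at h2
    rw [abs_of_nonpos (sub_nonpos.2 huv)]
    have := abs_sub (f u) (f v)
    nlinarith
  · rw [hij] at u1 u2
    exact hf j u v u1 u2 v1 v2

/-- The `P`-periodic extension of the restriction of `g` to `[-P/2, P/2]`. -/
noncomputable def periodize (P : ℝ) (g : ℝ → ℝ) (t : ℝ) : ℝ :=
  g (t - P * round (t / P))

theorem periodize_add_int_mul {P : ℝ} (hP : 0 < P) (g : ℝ → ℝ) (t : ℝ) (j : ℤ) :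
    periodize P g (t + j * P) = periodize P g t := by
  have : (t + j * P) / P = t / P + j := by field_simp
  rw [periodize, this, round_add_intCast, periodize]
  push_cast
  congr 1
  ring

theorem abs_sub_mul_round_le {P : ℝ} (hP : 0 < P) (t : ℝ) : |t - P * round (t / P)| ≤ P / 2 := by
  have := abs_sub_round (t / P)
  have e : t - P * round (t / P) = P * (t / P - round (t / P)) := by field_simp
  rw [e, abs_mul, abs_of_pos hP]
  nlinarith

/-- The blocks `[P * j - P / 2, P * j + P / 2]` on which the periodization is a translate of `g`
may be enlarged up to the support of the neighbouring translates. -/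
theorem periodize_eq {P ρ : ℝ} {g : ℝ → ℝ} (hP : 0 < P)
    (hg : ∀ t, ρ < |t| → g t = 0) (j : ℤ) {t : ℝ} (ht : |t - P * j| < P - ρ) :
    periodize P g t = g (t - P * j) := by
  rw [periodize]
  have h1 := abs_sub_mul_round_le hP t
  set i := round (t / P)
  by_cases hij : i = j
  · rw [hij]
  · have h2 : (1 : ℝ) ≤ |(i : ℝ) - j| := by
      have : (1 : ℤ) ≤ |i - j| := Int.one_le_abs (sub_ne_zero.2 hij)
      exact_mod_cast this
    have h3 : P ≤ |t - P * i| + |t - P * j| := by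
      have e : P * |(i : ℝ) - j| = |(t - P * j) - (t - P * i)| := by
        rw [← abs_of_pos hP, ← abs_mul, abs_of_pos hP]; congr 1; ring
      have := abs_sub (t - P * j) (t - P * i)
      nlinarith
    -- Both translates vanish at `t`, since `t` is far from both centres.
    rw [hg _ (by linarith), hg _ (by linarith)]

theorem BoundedTower.periodize {n : ℕ} {B : ℕ → ℝ} {G : ℕ → ℝ → ℝ} (h : BoundedTower n B G)
    (hB : 0 ≤ B (n + 1)) {P ρ : ℝ} (hP : 0 < P) (hρ : ρ < P / 2)
    (hG : ∀ k t, ρ < |t| → G k t = 0) :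
    BoundedTower n B (fun k => RodovComparison.periodize P (G k)) where
  hasDerivAt k hk t := by
    have h1 := abs_sub_mul_round_le hP t
    set j := round (t / P)
    have h2 : |t - P * j| < P - ρ := by linarith
    have h3 : RodovComparison.periodize P (G k) =ᶠ[nhds t] fun s => G k (s - P * j) := by
      filter_upwards [(isOpen_lt (by fun_prop : Continuous fun s : ℝ => |s - P * j|)
        continuous_const).mem_nhds h2] with s hs
      exact periodize_eq hP (hG k) j hs
    rw [periodize_eq hP (hG (k + 1)) j h2]
    exact ((h.hasDerivAt k hk (t - P * j)).comp_sub_const t (P * j)).congr_of_eventuallyEq h3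
  bound k hk t := h.bound k hk _
  lip := by
    have hj : ∀ (j : ℤ) u, -(P / 2) + j * P ≤ u → u ≤ -(P / 2) + (j + 1) * P →
        RodovComparison.periodize P (G n) u = G n (u - P * j) := by
      intro j u h1 h2
      refine periodize_eq hP (hG n) j ?_
      have : |u - P * j| ≤ P / 2 := by rw [abs_le]; constructor <;> linarith
      linarith
    refine lipschitz_of_lipschitz_on_blocks (a := -(P / 2)) hP hB ?_ ?_
    · intro j
      rw [hj j _ le_rfl (by linarith)]
      refine hG n _ ?_
      have e : -(P / 2) + j * P - P * j = -(P / 2) := by ring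
      rw [e, abs_neg, abs_of_pos (by linarith)]
      exact hρ
    · intro j u v u1 u2 v1 v2
      rw [hj j u u1 u2, hj j v v1 v2]
      simpa using h.lip (u - P * j) (v - P * j)

/-- Every bounded tower agrees on a given bounded interval with a periodic one whose bounds are
larger by an arbitrarily small factor; the period may be any large multiple of a given one. -/
theorem BoundedTower.exists_periodic {n : ℕ} {B : ℕ → ℝ} {X : ℕ → ℝ → ℝ} (h : BoundedTower n B X)
    (hB : ∀ k ≤ n + 1, 0 < B k) {θ : ℝ} (hθ : 1 < θ) (R : ℝ) {S : ℝ} (hS : 0 < S) :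
    ∃ (m : ℕ) (Y : ℕ → ℝ → ℝ), 1 ≤ m ∧ BoundedTower n (fun k => θ * B k) Y ∧
      (∀ t, |t| ≤ R → Y 0 t = X 0 t) ∧ ∀ t (j : ℤ), Y 0 (t + j * (m * S)) = Y 0 t := by
  obtain ⟨N₀, hN₀⟩ := h.exists_cutoff hB hθ
  obtain ⟨m, hm⟩ := exists_nat_ge (max 1 (max (8 * N₀ / S) (8 * R / S)))
  have hm1 : (1 : ℝ) ≤ m := (le_max_left _ _).trans hm
  have hm2 : 8 * N₀ ≤ m * S :=
    (div_le_iff₀ hS).1 (((le_max_left _ _).trans (le_max_right _ _)).trans hm)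
  have hm3 : 8 * R ≤ m * S :=
    (div_le_iff₀ hS).1 (((le_max_right _ _).trans (le_max_right _ _)).trans hm)
  have hP : 0 < m * S := by positivity
  obtain ⟨G, hG, hG1, hG2⟩ := hN₀ (m * S / 8) (by linarith)
  refine ⟨m, fun k => RodovComparison.periodize (m * S) (G k), by exact_mod_cast hm1,
    hG.periodize (mul_nonneg (by linarith) (hB _ le_rfl).le) hP (ρ := 2 * (m * S / 8))
      (by linarith) hG2, ?_, fun t j => periodize_add_int_mul hP _ t j⟩
  intro t ht
  have := periodize_eq hP (ρ := 2 * (m * S / 8)) (hG2 0) 0 (t := t)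
    (by simp; linarith)
  simp only [Int.cast_zero, mul_zero, sub_zero] at this
  simp only [this]
  exact hG1 t (by linarith)

/-! ### Antiperiodic functions -/

/-- A point is moved into `[o, o + T)` by an integer number of half-periods. -/
theorem exists_int_mul_mem_Ico {T : ℝ} (hT : 0 < T) (o t : ℝ) :
    ∃ j : ℤ, o ≤ t + j * T ∧ t + j * T < o + T := by
  refine ⟨-⌊(t - o) / T⌋, ?_⟩
  have h1 := Int.floor_le ((t - o) / T)
  have h2 := Int.lt_floor_add_one ((t - o) / T)
  rw [le_div_iff₀ hT] at h1
  rw [div_lt_iff₀ hT] at h2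
  push_cast
  constructor <;> linarith

theorem antiperiodic_add_int_mul {f : ℝ → ℝ} {T : ℝ} (hf : Function.Antiperiodic f T) (t : ℝ)
    (j : ℤ) : f (t + j * T) = (-1 : ℝ) ^ j * f t := by
  rw [hf.add_int_mul_eq j]
  rcases Int.even_or_odd j with hj | hj
  · simp [Int.negOnePow_even _ hj, hj.neg_one_zpow]
  · simp [Int.negOnePow_odd _ hj, hj.neg_one_zpow]

theorem abs_neg_one_zpow_mul (j : ℤ) (a : ℝ) : |(-1 : ℝ) ^ j * a| = |a| := by
  rw [abs_mul, abs_zpow, abs_neg, abs_one, one_zpow, one_mul]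

/-! ### Alternating sequences -/

/-- The values of `f` along the increasing sequence `t` are nonzero and alternate in sign,
starting with a positive one. -/
def Alternating (f : ℝ → ℝ) (t : ℕ → ℝ) : Prop :=
  StrictMono t ∧ ∀ i, 0 < (-1 : ℝ) ^ i * f (t i)

/-- Rolle's theorem for alternating sequences. The shift of the index by one makes the sequence
for the derivative start with a positive value too. -/
theorem Alternating.deriv {f f' : ℝ → ℝ} {t : ℕ → ℝ} (h : Alternating f t)
    (hf : ∀ u, HasDerivAt f (f' u) u) :
    ∃ s, Alternating f' s ∧ ∀ i, t (i + 1) < s i ∧ s i < t (i + 2) := by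
  have key : ∀ i, ∃ c, t (i + 1) < c ∧ c < t (i + 2) ∧ 0 < (-1 : ℝ) ^ i * f' c := by
    intro i
    have hlt : t (i + 1) < t (i + 2) := h.1 (by omega)
    obtain ⟨c, hc, hc'⟩ := exists_hasDerivAt_eq_slope f f' hlt
      (fun y _ => (hf y).continuousAt.continuousWithinAt) (fun y _ => hf y)
    refine ⟨c, hc.1, hc.2, ?_⟩
    rw [hc', ← mul_div_assoc]
    refine div_pos ?_ (sub_pos.2 hlt)
    have h1 := h.2 (i + 1)
    have h2 := h.2 (i + 2)
    rw [pow_add] at h1 h2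
    linarith
  choose s h1 h2 h3 using key
  exact ⟨s, ⟨strictMono_nat_of_lt_succ fun i => (h2 i).trans (h1 (i + 1)), h3⟩,
    fun i => ⟨h1 i, h2 i⟩⟩

theorem Alternating.iterate_deriv {F : ℕ → ℝ → ℝ} {t : ℕ → ℝ} (h : Alternating (F 0) t) (d : ℕ)
    (hF : ∀ k < d, ∀ u, HasDerivAt (F k) (F (k + 1) u) u) :
    ∃ s, Alternating (F d) s ∧ ∀ i, t 0 ≤ s i ∧ s i ≤ t (i + 2 * d) := by
  induction d with
  | zero => exact ⟨t, h, fun i => ⟨h.1.monotone (Nat.zero_le i), by simp⟩⟩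
  | succ d ih =>
    obtain ⟨s, hs, hs'⟩ := ih fun k hk => hF k (by omega)
    obtain ⟨w, hw, hw'⟩ := hs.deriv (hF d (by omega))
    refine ⟨w, hw, fun i => ⟨(hs' _).1.trans (hw' i).1.le, (hw' i).2.le.trans ?_⟩⟩
    have := (hs' (i + 2)).2
    rwa [show i + 2 + 2 * d = i + 2 * (d + 1) by ring] at this

/-- If `f` changes sign at most once, and in the direction prescribed by the parity of the block,
in each block of length `T`, then an alternating sequence has at most one term per block, up to
an additive constant. -/
theorem Alternating.le_div_add_two {f : ℝ → ℝ} {t : ℕ → ℝ} (h : Alternating f t) {T o : ℝ}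
    (hT : 0 < T)
    (hf : ∀ j : ℤ, ∀ u v, o + j * T ≤ u → u < v → v < o + (j + 1) * T →
      (-1 : ℝ) ^ j * f u < 0 → (-1 : ℝ) ^ j * f v ≤ 0) (K : ℕ) :
    (K : ℝ) ≤ (t K - t 0) / T + 2 := by
  let J : ℕ → ℤ := fun i => ⌊(t i - o) / T⌋
  have hJ : ∀ i, o + J i * T ≤ t i ∧ t i < o + (J i + 1) * T := by
    intro i
    have h1 := Int.floor_le ((t i - o) / T)
    have h2 := Int.lt_floor_add_one ((t i - o) / T)
    rw [le_div_iff₀ hT] at h1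
    rw [div_lt_iff₀ hT] at h2
    constructor <;> simp only [J] <;> linarith
  have hJmono : ∀ i, J i ≤ J (i + 1) := by
    intro i
    have := h.1 (Nat.lt_succ_self i)
    simp only [J]
    gcongr
  -- The phase: the number of the block, plus one if the sign change of the block is over.
  let φ : ℕ → ℤ := fun i => if 0 < (-1 : ℝ) ^ (J i) * f (t i) then J i else J i + 1
  have hφ1 : ∀ i, J i ≤ φ i ∧ φ i ≤ J i + 1 := by
    intro i
    simp only [φ]
    split_ifs <;> constructor <;> omega
  have hne : ∀ i, f (t i) ≠ 0 := fun i hi => by simpa [hi] using h.2 i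
  have hsgn : ∀ i, 0 < (-1 : ℝ) ^ (φ i) * f (t i) := by
    intro i
    simp only [φ]
    split_ifs with hi
    · exact hi
    · have h1 : (-1 : ℝ) ^ (J i) * f (t i) ≠ 0 :=
        mul_ne_zero (zpow_ne_zero _ (by norm_num)) (hne i)
      have h2 := lt_of_le_of_ne (not_lt.1 hi) h1
      rw [zpow_add_one₀ (by norm_num)]
      linarith
  have hmono : ∀ i, φ i ≤ φ (i + 1) := by
    intro i
    rcases (hJmono i).lt_or_eq with hlt | heq
    · linarith [(hφ1 i).2, (hφ1 (i + 1)).1]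
    · by_cases hi : 0 < (-1 : ℝ) ^ (J i) * f (t i)
      · have : φ i = J i := if_pos hi
        linarith [(hφ1 (i + 1)).1]
      · have h1 : (-1 : ℝ) ^ (J i) * f (t i) ≠ 0 :=
          mul_ne_zero (zpow_ne_zero _ (by norm_num)) (hne i)
        have h2 := lt_of_le_of_ne (not_lt.1 hi) h1
        have h3 := hf (J i) (t i) (t (i + 1)) (hJ i).1 (h.1 (Nat.lt_succ_self i))
          (by have := (hJ (i + 1)).2; rwa [← heq] at this) h2
        have h4 : φ (i + 1) = J (i + 1) + 1 := if_neg (by rw [← heq]; exact not_lt.2 h3)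
        linarith [(hφ1 i).2]
  have hstep : ∀ i, φ i + 1 ≤ φ (i + 1) := by
    intro i
    refine lt_of_le_of_ne (hmono i) fun he => ?_
    have h1 := hsgn i
    have h2 := hsgn (i + 1)
    rw [← he] at h2
    have h3 := h.2 i
    have h4 := h.2 (i + 1)
    rw [pow_succ] at h4
    have h5 := mul_pos (mul_pos h1 h2) (mul_pos h3 h4)
    have h6 : (-1 : ℝ) ^ φ i * f (t i) * ((-1) ^ φ i * f (t (i + 1))) *
        ((-1) ^ i * f (t i) * ((-1) ^ i * -1 * f (t (i + 1)))) =
        -((-1 : ℝ) ^ φ i * (-1) ^ i * f (t i) * f (t (i + 1))) ^ 2 := by ring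
    rw [h6] at h5
    nlinarith [sq_nonneg ((-1 : ℝ) ^ φ i * (-1) ^ i * f (t i) * f (t (i + 1)))]
  have hK : φ 0 + K ≤ φ K := by
    induction K with
    | zero => simp
    | succ K ih => push_cast; linarith [hstep K]
  have h1 : ((J 0 : ℤ) : ℝ) + K ≤ J K + 1 := by
    have : J 0 + K ≤ J K + 1 := by linarith [(hφ1 0).1, (hφ1 K).2]
    exact_mod_cast this
  have h2 := (hJ 0).2
  have h3 := (hJ K).1
  rw [← sub_le_iff_le_add, le_div_iff₀ hT]
  nlinarith

/-! ### The comparison argument -/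

/-- Data for the comparison argument: a tower `Φ` over a `T`-antiperiodic function with largest
value `B 0`, attained at `q + T`, such that for every tower `Y` within the bounds `B` and every
translate of `Φ` the difference of the `d`-th derivatives changes sign at most once per half-period
`T`, in alternating directions. -/
structure ComparisonTower (n d : ℕ) (B : ℕ → ℝ) (Φ : ℕ → ℝ → ℝ) (T q : ℝ) : Prop where
  one_le : 1 ≤ n
  le : d ≤ n
  pos : 0 < T
  bound_pos : ∀ k ≤ n + 1, 0 < B k
  hasDerivAt : ∀ k < n, ∀ t, HasDerivAt (Φ k) (Φ (k + 1) t) t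
  antiperiodic : Function.Antiperiodic (Φ 0) T
  bound : ∀ t, |Φ 0 t| ≤ B 0
  min_eq : Φ 0 q = -B 0
  sign_change : ∀ Y, BoundedTower n B Y → ∀ s, ∃ o, ∀ j : ℤ, ∀ u v, o + j * T ≤ u → u < v →
    v < o + (j + 1) * T → (-1 : ℝ) ^ j * (Y d u - Φ d (u + s)) < 0 →
    (-1 : ℝ) ^ j * (Y d v - Φ d (v + s)) ≤ 0

namespace ComparisonTower

variable {n d : ℕ} {B : ℕ → ℝ} {Φ : ℕ → ℝ → ℝ} {T q : ℝ}

/-- A periodic function within the bounds cannot cross `Φ` three times in a half-period in which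
`Φ` goes from its smallest to its largest value: repeated in every period, the two additional
sign changes would survive all differentiations. -/
theorem not_crossing (h : ComparisonTower n d B Φ T q) {Y : ℕ → ℝ → ℝ} (hY : BoundedTower n B Y)
    (hlt : ∀ t, |Y 0 t| < B 0) {m : ℕ} (hm : 1 ≤ m)
    (hper : ∀ t (j : ℤ), Y 0 (t + j * (m * (2 * T))) = Y 0 t) {ξ u v : ℝ}
    (hu : q - ξ < u) (huv : u < v) (hv : v < q + T - ξ) (hu' : Y 0 u < Φ 0 (u + ξ))
    (hv' : Φ 0 (v + ξ) < Y 0 v) : False := by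
  have hT := h.pos
  -- One period of the alternating sequence: the minimum of the translate of `Φ 0`, the crossing,
  -- and then the extrema, one per half-period. These are `2 * m + 2` points in `2 * m` half-periods.
  let w : ℕ → ℝ := fun s => if s = 0 then q - ξ else if s = 1 then u else if s = 2 then v else
    q - ξ + (s - 2) * T
  let t : ℕ → ℝ := fun i => (i / (2 * m + 2) : ℕ) * (m * (2 * T)) + w (i % (2 * m + 2))
  have hw : ∀ s, w s < w (s + 1) := by
    intro s
    rcases s with _ | _ | _ | s
    · simpa [w] using hu
    · simpa [w] using huv
    · simp [w]; linarith
    · simp [w]; linarith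
  have ht : StrictMono t := by
    refine strictMono_nat_of_lt_succ fun i => ?_
    simp only [t]
    have hmod := Nat.mod_lt i (show 0 < 2 * m + 2 by omega)
    rcases Nat.lt_or_ge (i % (2 * m + 2) + 1) (2 * m + 2) with h1 | h1
    · have e1 : (i + 1) % (2 * m + 2) = i % (2 * m + 2) + 1 := by
        rw [Nat.add_mod, Nat.mod_eq_of_lt (show 1 < 2 * m + 2 by omega), Nat.mod_eq_of_lt h1]
      have e2 : (i + 1) / (2 * m + 2) = i / (2 * m + 2) := by
        rw [Nat.succ_div_of_not_dvd]
        rw [Nat.dvd_iff_mod_eq_zero, e1]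
        omega
      rw [e1, e2]
      linarith [hw (i % (2 * m + 2))]
    · have e0 : i % (2 * m + 2) = 2 * m + 1 := by omega
      have hdvd : (2 * m + 2) ∣ i + 1 := by
        rw [Nat.dvd_iff_mod_eq_zero, Nat.add_mod, e0]
        rw [Nat.mod_eq_of_lt (show 1 < 2 * m + 2 by omega)]
        exact Nat.mod_self _
      have e1 : (i + 1) % (2 * m + 2) = 0 := Nat.mod_eq_zero_of_dvd hdvd
      have e2 : (i + 1) / (2 * m + 2) = i / (2 * m + 2) + 1 := Nat.succ_div_of_dvd hdvd
      have e3 : w (2 * m + 1) = q - ξ + (2 * m - 1) * T := by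
        have a1 : 2 * m ≠ 0 := by omega
        have a2 : 2 * m + 1 ≠ 2 := by omega
        simp only [w, a2, if_false, Nat.succ_ne_zero, Nat.add_eq_right, a1]
        push_cast
        ring
      rw [e0, e1, e2, e3]
      simp only [w, if_true]
      push_cast
      linarith
  have hanti : ∀ (j : ℕ) s, Φ 0 (s + j * T) = (-1) ^ j * Φ 0 s := by
    intro j s
    have := h.antiperiodic.add_nsmul_eq (x := s) j
    simpa using this
  have hwsign : ∀ s, 0 < (-1 : ℝ) ^ s * (Y 0 (w s) - Φ 0 (w s + ξ)) := by
    intro s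
    rcases s with _ | _ | _ | s
    · have := (abs_lt.1 (hlt (q - ξ))).1
      simp [w, h.min_eq]
      linarith
    · simp [w]; linarith
    · simp [w]; linarith
    · have e : w (s + 3) = q - ξ + (s + 1 : ℕ) * T := by
        simp [w]
        left
        ring
      have e2 : w (s + 3) + ξ = q + (s + 1 : ℕ) * T := by rw [e]; ring
      rw [e2, hanti, h.min_eq]
      have h1 := abs_lt.1 (hlt (w (s + 3)))
      rcases Nat.even_or_odd s with hs | hs
      · simp only [pow_succ, hs.neg_one_pow]
        linarith
      · simp only [pow_succ, hs.neg_one_pow]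
        linarith
  have hsign : ∀ i, 0 < (-1 : ℝ) ^ i * (Y 0 (t i) - Φ 0 (t i + ξ)) := by
    intro i
    have h1 := hwsign (i % (2 * m + 2))
    have e1 : (-1 : ℝ) ^ i = (-1) ^ (i % (2 * m + 2)) := by
      conv_lhs => rw [← Nat.div_add_mod i (2 * m + 2), pow_add, pow_mul]
      have : Even (2 * m + 2) := ⟨m + 1, by ring⟩
      rw [this.neg_one_pow, one_pow, one_mul]
    have e2 : Y 0 (t i) = Y 0 (w (i % (2 * m + 2))) := by
      have := hper (w (i % (2 * m + 2))) ((i / (2 * m + 2) : ℕ) : ℤ)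
      rw [← this]
      simp only [t, Int.cast_natCast]
      rw [add_comm]
    have e3 : Φ 0 (t i + ξ) = Φ 0 (w (i % (2 * m + 2)) + ξ) := by
      have := hanti ((i / (2 * m + 2)) * m * 2) (w (i % (2 * m + 2)) + ξ)
      rw [(even_two.mul_left _).neg_one_pow, one_mul] at this
      rw [← this]
      congr 1
      simp only [t]
      push_cast
      ring
    rw [e1, e2, e3]
    exact h1
  obtain ⟨s, hs, hs'⟩ := Alternating.iterate_deriv (F := fun k x => Y k x - Φ k (x + ξ)) (t := t)
    ⟨ht, hsign⟩ d fun k hk x => (hY.hasDerivAt k (by have := h.le; omega) x).sub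
      ((h.hasDerivAt k (by have := h.le; omega) (x + ξ)).comp_add_const x ξ)
  obtain ⟨o, ho⟩ := h.sign_change Y hY ξ
  -- In `d + 2` periods there are `2 (d + 2)` additional sign changes, of which `2 d` can be lost.
  have h1 := hs.le_div_add_two hT ho ((2 * m + 2) * (d + 2) - 2 * d)
  have hge : 2 * d ≤ (2 * m + 2) * (d + 2) := by nlinarith
  have h2 := (hs' ((2 * m + 2) * (d + 2) - 2 * d)).2
  have h3 := (hs' 0).1
  rw [Nat.sub_add_cancel hge] at h2
  have e4 : t ((2 * m + 2) * (d + 2)) = t 0 + (d + 2) * (m * (2 * T)) := by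
    simp only [t, Nat.mul_div_cancel_left _ (show 0 < 2 * m + 2 by omega), Nat.mul_mod_right,
      Nat.zero_div, Nat.zero_mod]
    push_cast
    ring
  rw [Nat.cast_sub hge] at h1
  have h5 : s ((2 * m + 2) * (d + 2) - 2 * d) - s 0 ≤ (d + 2) * (m * 2) * T := by
    rw [e4] at h2
    linarith
  have h6 := (div_le_iff₀ hT).2 h5
  push_cast at h1
  nlinarith

/-- On a half-period in which `Φ` goes from its smallest to its largest value, a function within
the bounds does not grow faster than `Φ` at equal values. -/
theorem le_of_mem_Icc (h : ComparisonTower n d B Φ T q) {X : ℕ → ℝ → ℝ}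
    (hX : BoundedTower n B X) {ξ : ℝ} (hξ : ξ ∈ Set.Icc q (q + T)) (h0 : X 0 0 = Φ 0 ξ) :
    X 1 0 ≤ Φ 1 ξ := by
  have hX0 := hX.hasDerivAt 0 h.one_le 0
  have hΦ0 := h.hasDerivAt 0 h.one_le ξ
  have hB0 := h.bound_pos 0 (by omega)
  simp only [zero_add] at hX0 hΦ0
  have hmax : Φ 0 (q + T) = B 0 := by rw [h.antiperiodic, h.min_eq, neg_neg]
  have hXb := fun t => abs_le.1 (hX.bound 0 (Nat.zero_le _) t)
  have hΦb := fun t => abs_le.1 (h.bound t)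
  -- At the ends of the half-period both derivatives vanish.
  rcases eq_or_ne ξ q with rfl | hq
  · have h1 : IsLocalMin (X 0) 0 :=
      Filter.Eventually.of_forall fun t => by rw [h0, h.min_eq]; exact (hXb t).1
    have h2 : IsLocalMin (Φ 0) ξ :=
      Filter.Eventually.of_forall fun t => by rw [h.min_eq]; exact (hΦb t).1
    rw [h1.hasDerivAt_eq_zero hX0, h2.hasDerivAt_eq_zero hΦ0]
  rcases eq_or_ne ξ (q + T) with rfl | hqT
  · have h1 : IsLocalMax (X 0) 0 :=
      Filter.Eventually.of_forall fun t => by rw [h0, hmax]; exact (hXb t).2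
    have h2 : IsLocalMax (Φ 0) (q + T) :=
      Filter.Eventually.of_forall fun t => by rw [hmax]; exact (hΦb t).2
    rw [h1.hasDerivAt_eq_zero hX0, h2.hasDerivAt_eq_zero hΦ0]
  have hlo : q < ξ := lt_of_le_of_ne hξ.1 hq.symm
  have hhi : ξ < q + T := lt_of_le_of_ne hξ.2 hqT
  by_contra! hcon
  -- Points `-ε` and `ε` around the violation at which the difference has strict signs.
  obtain ⟨ε, hε, hε1, hε2, hl, hr⟩ : ∃ ε > 0, ε < ξ - q ∧ ε < q + T - ξ ∧
      X 0 (-ε) < Φ 0 (-ε + ξ) ∧ Φ 0 (ε + ξ) < X 0 ε := by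
    have hδ : HasDerivAt (fun t => X 0 t - Φ 0 (t + ξ)) (X 1 0 - Φ 1 ξ) 0 := by
      have : HasDerivAt (Φ 0) (Φ 1 ξ) (0 + ξ) := by rwa [zero_add]
      exact hX0.sub (this.comp_add_const 0 ξ)
    have hs := hasDerivAt_iff_tendsto_slope.1 hδ
    have hpos : ∀ᶠ t in nhdsWithin (0 : ℝ) {0}ᶜ,
        0 < slope (fun t => X 0 t - Φ 0 (t + ξ)) 0 t := hs.eventually_const_lt (by linarith)
    rw [eventually_nhdsWithin_iff, Metric.eventually_nhds_iff] at hpos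
    obtain ⟨r, hr, hr'⟩ := hpos
    have hz : X 0 0 - Φ 0 (0 + ξ) = 0 := by rw [zero_add, h0, sub_self]
    have hmin : 0 < min r (min (ξ - q) (q + T - ξ)) :=
      lt_min hr (lt_min (by linarith) (by linarith))
    set ε := min r (min (ξ - q) (q + T - ξ)) / 2 with hεd
    have hε : 0 < ε := by positivity
    have hεr : ε < r := by have := min_le_left r (min (ξ - q) (q + T - ξ)); linarith
    have hε1 : ε < ξ - q := by
      have := (min_le_right r (min (ξ - q) (q + T - ξ))).trans (min_le_left _ _); linarith
    have hε2 : ε < q + T - ξ := by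
      have := (min_le_right r (min (ξ - q) (q + T - ξ))).trans (min_le_right _ _); linarith
    have p1 := hr' (y := -ε) (by simpa [abs_of_pos hε] using hεr) (by simpa using hε.ne')
    have p2 := hr' (y := ε) (by simpa [abs_of_pos hε] using hεr) (by simpa using hε.ne')
    rw [slope_def_field, hz, sub_zero, sub_zero] at p1 p2
    refine ⟨ε, hε, hε1, hε2, ?_, ?_⟩
    · rcases div_pos_iff.1 p1 with p | p <;> linarith [p.1, p.2]
    · rcases div_pos_iff.1 p2 with p | p <;> linarith [p.1, p.2]
  -- The strict inequalities leave room for a factor `θ⁻²`.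
  obtain ⟨θ, hθ, hθl, hθr⟩ : ∃ θ : ℝ, 1 < θ ∧ (θ ^ 2)⁻¹ * X 0 (-ε) < Φ 0 (-ε + ξ) ∧
      Φ 0 (ε + ξ) < (θ ^ 2)⁻¹ * X 0 ε := by
    have hc : ContinuousAt (fun θ : ℝ => (θ ^ 2)⁻¹) 1 := by
      refine ContinuousAt.inv₀ (by fun_prop) (by norm_num)
    have e1 : ∀ᶠ θ in nhds (1 : ℝ), (θ ^ 2)⁻¹ * X 0 (-ε) < Φ 0 (-ε + ξ) :=
      (hc.mul continuousAt_const).eventually_lt_const (by simpa using hl)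
    have e2 : ∀ᶠ θ in nhds (1 : ℝ), Φ 0 (ε + ξ) < (θ ^ 2)⁻¹ * X 0 ε :=
      (hc.mul continuousAt_const).eventually_const_lt (by simpa using hr)
    have e3 : ∀ᶠ θ in nhdsWithin (1 : ℝ) (Set.Ioi 1), 1 < θ := self_mem_nhdsWithin
    obtain ⟨θ, ⟨h1, h2⟩, h3⟩ := (((e1.and e2).filter_mono nhdsWithin_le_nhds).and e3).exists
    exact ⟨θ, h3, h1, h2⟩
  obtain ⟨m, Y, hm, hY, hYX, hper⟩ := hX.exists_periodic h.bound_pos hθ ε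
    (show 0 < 2 * T by linarith [h.pos])
  have hθ0 : 0 < θ := by linarith
  have hinv : θ⁻¹ < 1 := inv_lt_one_of_one_lt₀ hθ
  have hc0 : 0 ≤ (θ ^ 2)⁻¹ := by positivity
  have e : ∀ k, (θ ^ 2)⁻¹ * (θ * B k) = θ⁻¹ * B k := fun k => by field_simp
  have hZ := hY.const_mul hc0
  have hZ' : BoundedTower n B (fun k t => (θ ^ 2)⁻¹ * Y k t) := by
    refine hZ.mono fun k hk => ?_
    rw [e]
    have := h.bound_pos k hk
    nlinarith
  refine h.not_crossing hZ' (fun t => ?_) hm (fun t j => by rw [hper]) (ξ := ξ) (u := -ε) (v := ε)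
    (by linarith) (by linarith) (by linarith) ?_ ?_
  · refine (hZ.bound 0 (Nat.zero_le _) t).trans_lt ?_
    rw [e]
    nlinarith
  · rw [hYX _ (by rw [abs_neg, abs_of_pos hε])]
    exact hθl
  · rw [hYX _ (by rw [abs_of_pos hε])]
    exact hθr

/-- The lower bound for the derivative follows from the upper one by reflecting the argument of the
function, which is why no symmetry of `Φ` is needed. -/
theorem abs_le_of_mem_Icc (h : ComparisonTower n d B Φ T q) {X : ℕ → ℝ → ℝ}
    (hX : BoundedTower n B X) {τ ξ : ℝ} (hξ : ξ ∈ Set.Icc q (q + T)) (h0 : X 0 τ = Φ 0 ξ) :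
    |X 1 τ| ≤ |Φ 1 ξ| := by
  have h1 := h.le_of_mem_Icc (hX.translate τ) hξ (by simpa using h0)
  have h2 := h.le_of_mem_Icc (hX.translate τ).reflect hξ (by simpa using h0)
  simp only [zero_add, pow_one, neg_zero] at h1 h2
  exact (abs_le.2 ⟨by linarith, h1⟩).trans (le_abs_self _)

/-- At equal values, the derivative of a function within the bounds is at most that of `Φ`, in
absolute value. The half-periods in which `Φ` goes down are reduced to those in which it goes up
by changing the signs of both functions. -/
theorem abs_le (h : ComparisonTower n d B Φ T q) {X : ℕ → ℝ → ℝ}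
    (hX : BoundedTower n B X) {τ ξ : ℝ} (h0 : X 0 τ = Φ 0 ξ) : |X 1 τ| ≤ |Φ 1 ξ| := by
  have hanti1 : Function.Antiperiodic (Φ 1) T := fun t => by
    have h1 := (h.hasDerivAt 0 h.one_le (t + T)).comp_add_const t T
    have h2 := (h.hasDerivAt 0 h.one_le t).neg
    have e : (fun s => Φ 0 (s + T)) = -Φ 0 := funext h.antiperiodic
    rw [e] at h1
    exact h1.unique h2
  obtain ⟨j, hj1, hj2⟩ := exists_int_mul_mem_Ico h.pos q ξ
  have a0 := antiperiodic_add_int_mul h.antiperiodic ξ j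
  have a1 := antiperiodic_add_int_mul hanti1 ξ j
  rcases Int.even_or_odd j with hj | hj
  · rw [hj.neg_one_zpow, one_mul] at a0 a1
    rw [← a1]
    exact h.abs_le_of_mem_Icc hX ⟨hj1, hj2.le⟩ (h0.trans a0.symm)
  · rw [hj.neg_one_zpow, neg_one_mul] at a0 a1
    have := h.abs_le_of_mem_Icc hX.neg ⟨hj1, hj2.le⟩ (τ := τ) (by rw [h0, a0])
    rwa [a1, abs_neg, abs_neg] at this

end ComparisonTower

/-! ### The trapezoidal wave -/

section Wave

variable {a₁ a₂ : ℝ}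

theorem halfPeriod_pos (ha₁ : 0 ≤ a₁) (ha₂ : 0 ≤ a₂) : 0 < halfPeriod a₁ a₂ := by
  unfold halfPeriod; linarith

theorem trapezoid_eq_min (ha₂ : 0 ≤ a₂) (t : ℝ) :
    trapezoid a₁ a₂ t = min (max 0 (t - a₁)) (min 1 (halfPeriod a₁ a₂ - t)) := by
  unfold trapezoid halfPeriod
  split_ifs with h1 h2 h3
  · rw [max_eq_left (by linarith), min_eq_left (le_min zero_le_one (by linarith))]
  · rw [max_eq_right (by linarith), min_eq_left (le_min (by linarith) (by linarith))]
  · rw [max_eq_right (by linarith), min_eq_left (a := (1 : ℝ)) (by linarith),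
      min_eq_right (by linarith)]
  · rw [max_eq_right (by linarith), min_eq_right (a := (1 : ℝ)) (by linarith),
      min_eq_right (by linarith)]
    ring

theorem abs_trapezoid_sub_le (ha₂ : 0 ≤ a₂) (u v : ℝ) :
    |trapezoid a₁ a₂ u - trapezoid a₁ a₂ v| ≤ |u - v| := by
  rw [trapezoid_eq_min ha₂, trapezoid_eq_min ha₂]
  refine (abs_min_sub_min_le_max _ _ _ _).trans (max_le ?_ ?_)
  · refine (abs_max_sub_max_le_max _ _ _ _).trans (max_le ?_ ?_)
    · simp
    · simp
  · refine (abs_min_sub_min_le_max _ _ _ _).trans (max_le ?_ ?_)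
    · simp
    · rw [abs_sub_comm u v]; simp

theorem trapezoid_zero (ha₁ : 0 ≤ a₁) : trapezoid a₁ a₂ 0 = 0 := if_pos ha₁

theorem trapezoid_halfPeriod (ha₂ : 0 ≤ a₂) :
    trapezoid a₁ a₂ (halfPeriod a₁ a₂) = 0 := by
  rw [trapezoid_eq_min ha₂, sub_self, min_eq_right zero_le_one]
  exact min_eq_right (le_max_left _ _)

theorem trapezoid_nonneg (ha₂ : 0 ≤ a₂) {t : ℝ} (ht : t ≤ halfPeriod a₁ a₂) :
    0 ≤ trapezoid a₁ a₂ t := by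
  rw [trapezoid_eq_min ha₂]
  exact le_min (le_max_left _ _) (le_min zero_le_one (sub_nonneg.2 ht))

theorem trapezoid_le_one (ha₂ : 0 ≤ a₂) (t : ℝ) : trapezoid a₁ a₂ t ≤ 1 := by
  rw [trapezoid_eq_min ha₂]
  exact (min_le_right _ _).trans (min_le_left _ _)

theorem psiOne_eq_trapezoid (ha₁ : 0 ≤ a₁) (ha₂ : 0 ≤ a₂) {t : ℝ} (h0 : 0 ≤ t)
    (hT : t ≤ halfPeriod a₁ a₂) : psiOne a₁ a₂ t = trapezoid a₁ a₂ t := by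
  have hp := halfPeriod_pos ha₁ ha₂
  have hf : Int.fract (t / (2 * halfPeriod a₁ a₂)) = t / (2 * halfPeriod a₁ a₂) := by
    rw [Int.fract_eq_self]
    refine ⟨by positivity, ?_⟩
    rw [div_lt_one (by positivity)]
    linarith
  rw [psiOne, hf, mul_div_cancel₀ _ (by positivity), onePeriod, if_pos hT]

theorem psiOne_antiperiodic (ha₁ : 0 ≤ a₁) (ha₂ : 0 ≤ a₂) :
    Function.Antiperiodic (psiOne a₁ a₂) (halfPeriod a₁ a₂) := by
  intro t
  have hp := halfPeriod_pos ha₁ ha₂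
  have e : (t + halfPeriod a₁ a₂) / (2 * halfPeriod a₁ a₂) =
      t / (2 * halfPeriod a₁ a₂) + 1 / 2 := by field_simp
  rw [psiOne, psiOne, e]
  set s := t / (2 * halfPeriod a₁ a₂)
  set T := halfPeriod a₁ a₂ with hT
  have f0 := Int.fract_nonneg s
  have f1 := Int.fract_lt_one s
  have hz := trapezoid_zero (a₂ := a₂) ha₁
  have hTz := trapezoid_halfPeriod (a₁ := a₁) ha₂
  rw [← hT] at hTz
  rcases lt_or_ge (Int.fract s) (1 / 2) with hs | hs
  · have h1 : Int.fract (s + 1 / 2) = Int.fract s + 1 / 2 := by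
      rw [Int.fract_eq_iff]
      exact ⟨by linarith, by linarith, ⌊s⌋, by rw [Int.fract]; ring⟩
    rw [h1, onePeriod, onePeriod, ← hT]
    have h2 : 2 * T * Int.fract s ≤ T := by nlinarith
    have e2 : 2 * T * (Int.fract s + 1 / 2) - T = 2 * T * Int.fract s := by ring
    rw [if_pos h2, e2]
    split_ifs with h3
    · have h4 : Int.fract s = 0 := by nlinarith
      have e3 : 2 * T * (Int.fract s + 1 / 2) = T := by rw [h4]; ring
      rw [e3, h4, mul_zero, hz, hTz, neg_zero]
    · rfl
  · have h1 : Int.fract (s + 1 / 2) = Int.fract s - 1 / 2 := by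
      rw [Int.fract_eq_iff]
      refine ⟨by linarith, by linarith, ⌊s⌋ + 1, ?_⟩
      rw [Int.fract]; push_cast; ring
    rw [h1, onePeriod, onePeriod, ← hT]
    have h2 : 2 * T * (Int.fract s - 1 / 2) ≤ T := by nlinarith
    have e2 : 2 * T * (Int.fract s - 1 / 2) = 2 * T * Int.fract s - T := by ring
    rw [if_pos h2, e2]
    split_ifs with h3
    · have h4 : Int.fract s = 1 / 2 := by nlinarith
      have e3 : 2 * T * Int.fract s = T := by rw [h4]; ring
      rw [e3, sub_self, hz, hTz, neg_zero]
    · rw [neg_neg]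

theorem abs_psiOne_sub_le (ha₁ : 0 ≤ a₁) (ha₂ : 0 ≤ a₂) (u v : ℝ) :
    |psiOne a₁ a₂ u - psiOne a₁ a₂ v| ≤ 1 * |u - v| := by
  have hT := halfPeriod_pos ha₁ ha₂
  have key : ∀ (j : ℤ) u, 0 + j * halfPeriod a₁ a₂ ≤ u → u ≤ 0 + (j + 1) * halfPeriod a₁ a₂ →
      psiOne a₁ a₂ u = (-1 : ℝ) ^ j * trapezoid a₁ a₂ (u - j * halfPeriod a₁ a₂) := by
    intro j u h1 h2
    have := antiperiodic_add_int_mul (psiOne_antiperiodic ha₁ ha₂) (u - j * halfPeriod a₁ a₂) j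
    rw [sub_add_cancel] at this
    rw [this, psiOne_eq_trapezoid ha₁ ha₂ (by linarith) (by linarith)]
  refine lipschitz_of_lipschitz_on_blocks (a := 0) hT zero_le_one ?_ ?_ u v
  · intro j
    rw [key j _ le_rfl (by linarith)]
    simp [trapezoid_zero ha₁]
  · intro j u v u1 u2 v1 v2
    rw [key j u u1 u2, key j v v1 v2, ← mul_sub, abs_neg_one_zpow_mul, one_mul]
    simpa using abs_trapezoid_sub_le ha₂ (u - j * halfPeriod a₁ a₂) (v - j * halfPeriod a₁ a₂)

theorem continuous_psiOne (ha₁ : 0 ≤ a₁) (ha₂ : 0 ≤ a₂) : Continuous (psiOne a₁ a₂) :=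
  (LipschitzWith.of_dist_le_mul (K := 1) fun u v => abs_psiOne_sub_le ha₁ ha₂ u v).continuous

theorem abs_psiOne_le_one (ha₁ : 0 ≤ a₁) (ha₂ : 0 ≤ a₂) (t : ℝ) : |psiOne a₁ a₂ t| ≤ 1 := by
  obtain ⟨j, h1, h2⟩ := exists_int_mul_mem_Ico (halfPeriod_pos ha₁ ha₂) 0 t
  rw [← abs_neg_one_zpow_mul j, ← antiperiodic_add_int_mul (psiOne_antiperiodic ha₁ ha₂),
    psiOne_eq_trapezoid ha₁ ha₂ h1 (by linarith),
    abs_of_nonneg (trapezoid_nonneg ha₂ (by linarith))]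
  exact trapezoid_le_one ha₂ _

theorem psiOne_peak (ha₁ : 0 ≤ a₁) (ha₂ : 0 ≤ a₂) : psiOne a₁ a₂ (a₁ + 1) = 1 := by
  rw [psiOne_eq_trapezoid ha₁ ha₂ (by linarith) (by unfold halfPeriod; linarith)]
  simp [trapezoid]

/-! ### The periodic integrals of the wave -/

theorem hasDerivAt_zeroMeanPrimitive {f : ℝ → ℝ} (hf : Continuous f) (p t : ℝ) :
    HasDerivAt (zeroMeanPrimitive p f) (f t) t :=
  (intervalIntegral.integral_hasDerivAt_right (hf.intervalIntegrable _ _)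
    (hf.stronglyMeasurableAtFilter _ _) hf.continuousAt).sub_const _

theorem continuous_zeroMeanPrimitive {f : ℝ → ℝ} (hf : Continuous f) (p : ℝ) :
    Continuous (zeroMeanPrimitive p f) :=
  continuous_iff_continuousAt.2 fun t => (hasDerivAt_zeroMeanPrimitive hf p t).continuousAt

theorem integral_zeroMeanPrimitive {f : ℝ → ℝ} (hf : Continuous f) {p : ℝ} (hp : p ≠ 0) :
    ∫ t in (0 : ℝ)..p, zeroMeanPrimitive p f t = 0 := by
  unfold zeroMeanPrimitive
  have hc : Continuous fun t => ∫ s in (0 : ℝ)..t, f s :=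
    intervalIntegral.continuous_primitive (fun a b => hf.intervalIntegrable a b) 0
  rw [intervalIntegral.integral_sub (hc.intervalIntegrable _ _)
    (continuous_const.intervalIntegrable _ _), intervalIntegral.integral_const, sub_zero,
    smul_eq_mul, mul_inv_cancel_left₀ hp, sub_self]

/-- The zero-mean primitive of an antiperiodic function is antiperiodic: `F (t + T) + F t` is
constant, and has mean zero. -/
theorem antiperiodic_zeroMeanPrimitive {f : ℝ → ℝ} {T : ℝ} (hT : 0 < T) (hf : Continuous f)
    (hfT : Function.Antiperiodic f T) :
    Function.Antiperiodic (zeroMeanPrimitive (2 * T) f) T := by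
  set F := zeroMeanPrimitive (2 * T) f with hF
  have hFc : Continuous F := continuous_zeroMeanPrimitive hf _
  have hd : ∀ t, HasDerivAt (fun t => F (t + T) + F t) 0 t := by
    intro t
    have h1 := ((hasDerivAt_zeroMeanPrimitive hf (2 * T) (t + T)).comp_add_const t T).add
      (hasDerivAt_zeroMeanPrimitive hf (2 * T) t)
    rw [hfT, neg_add_cancel] at h1
    exact h1
  have hconst : ∀ t, F (t + T) + F t = F (0 + T) + F 0 := fun t =>
    is_const_of_deriv_eq_zero (fun t => (hd t).differentiableAt) (fun t => (hd t).deriv) t 0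
  have hper : Function.Periodic F (2 * T) := by
    intro t
    have h1 := hconst t
    have h2 := hconst (t + T)
    rw [show t + T + T = t + 2 * T by ring] at h2
    linarith
  have hint : ∫ t in (0 : ℝ)..2 * T, F t = 0 := integral_zeroMeanPrimitive hf (by positivity)
  have hint2 : ∫ t in (0 : ℝ)..2 * T, F (t + T) = 0 := by
    have := hper.intervalIntegral_add_eq T 0
    rw [zero_add] at this
    rw [intervalIntegral.integral_comp_add_right, zero_add, add_comm (2 * T), this, hint]
  have hsum : ∫ t in (0 : ℝ)..2 * T, (F (t + T) + F t) = 0 := by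
    rw [intervalIntegral.integral_add, hint, hint2, add_zero]
    · exact (hFc.comp (continuous_id.add continuous_const)).intervalIntegrable _ _
    · exact hFc.intervalIntegrable _ _
  simp_rw [hconst] at hsum
  rw [intervalIntegral.integral_const, sub_zero, smul_eq_mul] at hsum
  have hz := (mul_eq_zero.1 hsum).resolve_left (by positivity)
  intro t
  linarith [hconst t]

theorem psi_one : psi 1 a₁ a₂ = psiOne a₁ a₂ := rfl

theorem psi_succ {r : ℕ} (hr : 1 ≤ r) :
    psi (r + 1) a₁ a₂ = zeroMeanPrimitive (2 * halfPeriod a₁ a₂) (psi r a₁ a₂) := by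
  obtain ⟨k, rfl⟩ : ∃ k, r = k + 1 := ⟨r - 1, by omega⟩
  exact Function.iterate_succ_apply' _ k _

theorem continuous_psi (ha₁ : 0 ≤ a₁) (ha₂ : 0 ≤ a₂) {r : ℕ} (hr : 1 ≤ r) :
    Continuous (psi r a₁ a₂) := by
  induction r, hr using Nat.le_induction with
  | base => exact continuous_psiOne ha₁ ha₂
  | succ r hr ih => rw [psi_succ hr]; exact continuous_zeroMeanPrimitive ih _

theorem hasDerivAt_psi (ha₁ : 0 ≤ a₁) (ha₂ : 0 ≤ a₂) {r : ℕ} (hr : 1 ≤ r) (t : ℝ) :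
    HasDerivAt (psi (r + 1) a₁ a₂) (psi r a₁ a₂ t) t := by
  rw [psi_succ hr]
  exact hasDerivAt_zeroMeanPrimitive (continuous_psi ha₁ ha₂ hr) _ t

theorem psi_antiperiodic (ha₁ : 0 ≤ a₁) (ha₂ : 0 ≤ a₂) {r : ℕ} (hr : 1 ≤ r) :
    Function.Antiperiodic (psi r a₁ a₂) (halfPeriod a₁ a₂) := by
  induction r, hr using Nat.le_induction with
  | base => exact psiOne_antiperiodic ha₁ ha₂
  | succ r hr ih =>
    rw [psi_succ hr]
    exact antiperiodic_zeroMeanPrimitive (halfPeriod_pos ha₁ ha₂) (continuous_psi ha₁ ha₂ hr) ih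

theorem exists_psi_ne_zero (ha₁ : 0 ≤ a₁) (ha₂ : 0 ≤ a₂) {r : ℕ} (hr : 1 ≤ r) :
    ∃ t, psi r a₁ a₂ t ≠ 0 := by
  induction r, hr using Nat.le_induction with
  | base => exact ⟨a₁ + 1, by rw [psi_one, psiOne_peak ha₁ ha₂]; exact one_ne_zero⟩
  | succ r hr ih =>
    obtain ⟨t, ht⟩ := ih
    by_contra! h
    have h1 := hasDerivAt_psi ha₁ ha₂ hr t
    rw [show psi (r + 1) a₁ a₂ = fun _ => 0 from funext h] at h1
    exact ht (h1.unique (hasDerivAt_const t 0))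

/-- The norm of `ψ_r` is positive and attained as the negative of a value. -/
theorem exists_psi_min (ha₁ : 0 ≤ a₁) (ha₂ : 0 ≤ a₂) {r : ℕ} (hr : 1 ≤ r) :
    ∃ M > 0, (∀ t, |psi r a₁ a₂ t| ≤ M) ∧ ∃ q, psi r a₁ a₂ q = -M := by
  have hT := halfPeriod_pos ha₁ ha₂
  have hc := (continuous_psi ha₁ ha₂ hr).abs
  have hanti := psi_antiperiodic ha₁ ha₂ hr
  obtain ⟨p, -, hp⟩ := isCompact_Icc.exists_isMaxOn (Set.nonempty_Icc.2 hT.le) hc.continuousOn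
  have hb : ∀ t, |psi r a₁ a₂ t| ≤ |psi r a₁ a₂ p| := by
    intro t
    obtain ⟨j, h1, h2⟩ := exists_int_mul_mem_Ico hT 0 t
    rw [← abs_neg_one_zpow_mul j, ← antiperiodic_add_int_mul hanti]
    exact hp ⟨h1, by linarith⟩
  obtain ⟨t, ht⟩ := exists_psi_ne_zero ha₁ ha₂ hr
  refine ⟨|psi r a₁ a₂ p|, (abs_pos.2 ht).trans_le (hb t), hb, ?_⟩
  rcases le_total 0 (psi r a₁ a₂ p) with h | h
  · exact ⟨p + halfPeriod a₁ a₂, by rw [hanti, abs_of_nonneg h]⟩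
  · exact ⟨p, by rw [abs_of_nonpos h, neg_neg]⟩

theorem psiOne_nonneg (ha₁ : 0 ≤ a₁) (ha₂ : 0 ≤ a₂) {t : ℝ} (h0 : 0 ≤ t)
    (hT : t ≤ halfPeriod a₁ a₂) : 0 ≤ psiOne a₁ a₂ t := by
  rw [psiOne_eq_trapezoid ha₁ ha₂ h0 hT]
  exact trapezoid_nonneg ha₂ hT

theorem psi_two_monotoneOn (ha₁ : 0 ≤ a₁) (ha₂ : 0 ≤ a₂) :
    MonotoneOn (psi 2 a₁ a₂) (Set.Icc 0 (halfPeriod a₁ a₂)) := by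
  refine monotoneOn_of_hasDerivWithinAt_nonneg (convex_Icc _ _)
    (continuous_psi ha₁ ha₂ one_le_two).continuousOn
    (fun t _ => (hasDerivAt_psi ha₁ ha₂ le_rfl t).hasDerivWithinAt) fun t ht => ?_
  rw [interior_Icc] at ht
  exact psiOne_nonneg ha₁ ha₂ ht.1.le ht.2.le

theorem psi_two_halfPeriod (ha₁ : 0 ≤ a₁) (ha₂ : 0 ≤ a₂) :
    psi 2 a₁ a₂ (halfPeriod a₁ a₂) = -psi 2 a₁ a₂ 0 := by
  have := psi_antiperiodic ha₁ ha₂ one_le_two 0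
  rwa [zero_add] at this

theorem abs_psi_two_le (ha₁ : 0 ≤ a₁) (ha₂ : 0 ≤ a₂) (t : ℝ) :
    |psi 2 a₁ a₂ t| ≤ psi 2 a₁ a₂ (halfPeriod a₁ a₂) := by
  have hT := halfPeriod_pos ha₁ ha₂
  obtain ⟨j, h1, h2⟩ := exists_int_mul_mem_Ico hT 0 t
  rw [zero_add] at h2
  rw [← abs_neg_one_zpow_mul j, ← antiperiodic_add_int_mul (psi_antiperiodic ha₁ ha₂ one_le_two)]
  have hm := psi_two_monotoneOn ha₁ ha₂
  have l := hm ⟨le_rfl, hT.le⟩ ⟨h1, h2.le⟩ h1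
  have u := hm ⟨h1, h2.le⟩ ⟨hT.le, le_rfl⟩ h2.le
  have := psi_two_halfPeriod ha₁ ha₂
  exact abs_le.2 ⟨by linarith, u⟩

theorem psi_two_eq_of_le (ha₁ : 0 ≤ a₁) (ha₂ : 0 ≤ a₂) {t : ℝ} (h0 : 0 ≤ t) (ht : t ≤ a₁) :
    psi 2 a₁ a₂ t = psi 2 a₁ a₂ 0 := by
  have h := constant_of_has_deriv_right_zero (f := psi 2 a₁ a₂) (a := 0) (b := a₁)
    (continuous_psi ha₁ ha₂ one_le_two).continuousOn (fun s hs => by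
      have h1 := hasDerivAt_psi ha₁ ha₂ le_rfl s
      rw [psi_one, psiOne_eq_trapezoid ha₁ ha₂ hs.1 (by unfold halfPeriod; linarith [hs.2]),
        trapezoid, if_pos hs.2.le] at h1
      exact h1.hasDerivWithinAt)
  exact h t ⟨h0, ht⟩

end Wave

/-! ### The sign changes of the differences -/

/-- By antiperiodicity it suffices to consider a single block. -/
theorem sign_change_of_block {n d : ℕ} {B : ℕ → ℝ} {φ : ℝ → ℝ} {T o : ℝ}
    (hφ : Function.Antiperiodic φ T)
    (hblock : ∀ Y, BoundedTower n B Y → ∀ u v, o ≤ u → u < v → v < o + T →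
      Y d u - φ u < 0 → Y d v - φ v ≤ 0) (Y : ℕ → ℝ → ℝ) (hY : BoundedTower n B Y) (s : ℝ) :
    ∃ o, ∀ j : ℤ, ∀ u v, o + j * T ≤ u → u < v → v < o + (j + 1) * T →
      (-1 : ℝ) ^ j * (Y d u - φ (u + s)) < 0 → (-1 : ℝ) ^ j * (Y d v - φ (v + s)) ≤ 0 := by
  refine ⟨o - s, fun j u v hu huv hv => ?_⟩
  have h1 := hY.translate (-s + j * T)
  have e : ∀ w, φ (w + s) = (-1 : ℝ) ^ j * φ (w + s - j * T) := fun w => by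
    rw [← antiperiodic_add_int_mul hφ, sub_add_cancel]
  have e2 : ∀ w, w + s - j * T + (-s + j * T) = w := fun w => by ring
  rw [e u, e v]
  rcases Int.even_or_odd j with hj | hj
  · have h2 := hblock _ h1 (u + s - j * T) (v + s - j * T) (by linarith) (by linarith)
      (by linarith)
    simp only [e2] at h2
    simpa [hj.neg_one_zpow] using h2
  · have h2 := hblock _ h1.neg (u + s - j * T) (v + s - j * T) (by linarith) (by linarith)
      (by linarith)
    simp only [e2] at h2
    intro h3
    rw [hj.neg_one_zpow] at h3 ⊢
    linarith [h2 (by linarith)]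

theorem psiOne_zero_left {a₂ : ℝ} (ha₂ : 0 ≤ a₂) {t : ℝ} (h1 : -1 ≤ t) (h2 : t ≤ 1) :
    psiOne 0 a₂ t = t := by
  have hT : halfPeriod 0 a₂ = a₂ + 2 := by unfold halfPeriod; ring
  rcases le_total 0 t with h | h
  · rw [psiOne_eq_trapezoid le_rfl ha₂ h (by linarith), trapezoid_eq_min ha₂, hT, sub_zero,
      max_eq_right h, min_eq_left (le_min h2 (by linarith))]
  · have h3 := psiOne_antiperiodic le_rfl ha₂ t
    rw [psiOne_eq_trapezoid le_rfl ha₂ (by linarith) (by linarith), trapezoid_eq_min ha₂, hT,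
      sub_zero, max_eq_right (by linarith), min_eq_right (a := (1 : ℝ)) (by linarith),
      min_eq_right (by linarith)] at h3
    linarith

theorem psiOne_zero_left_plateau {a₂ : ℝ} (ha₂ : 0 ≤ a₂) {t : ℝ} (h1 : 1 ≤ t) (h2 : t ≤ 1 + a₂) :
    psiOne 0 a₂ t = 1 := by
  have hT : halfPeriod 0 a₂ = a₂ + 2 := by unfold halfPeriod; ring
  rw [psiOne_eq_trapezoid le_rfl ha₂ (by linarith) (by linarith), trapezoid_eq_min ha₂, hT,
    sub_zero, max_eq_right (by linarith), min_eq_left (a := (1 : ℝ)) (by linarith), min_eq_right h1]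

/-- Without zero plateaus the wave runs from `-1` to `1` with slope `1`, which a function with
Lipschitz constant `1` can cross in one direction only. -/
theorem block_psiOne {a₂ : ℝ} (ha₂ : 0 ≤ a₂) {n : ℕ} {B : ℕ → ℝ} (hB : B n ≤ 1)
    (hB' : B (n + 1) ≤ 1) (Y : ℕ → ℝ → ℝ) (hY : BoundedTower n B Y) (u v : ℝ) (hu : -1 ≤ u)
    (huv : u < v) (hv : v < -1 + halfPeriod 0 a₂) (h : Y n u - psiOne 0 a₂ u < 0) :
    Y n v - psiOne 0 a₂ v ≤ 0 := by
  have hT : halfPeriod 0 a₂ = a₂ + 2 := by unfold halfPeriod; ring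
  rcases le_total v 1 with hv1 | hv1
  · rw [psiOne_zero_left ha₂ hu (by linarith)] at h
    rw [psiOne_zero_left ha₂ (by linarith) hv1]
    have h1 := (le_abs_self _).trans (hY.lip v u)
    rw [abs_of_pos (sub_pos.2 huv)] at h1
    nlinarith
  · rw [psiOne_zero_left_plateau ha₂ hv1 (by linarith)]
    linarith [(abs_le.1 (hY.bound n le_rfl v)).2]

/-- On `[0, T]` the function `ψ₂` grows from its smallest value, which it takes on `[0, a₁]`, to
its largest value. The difference with a function whose derivative has Lipschitz constant `1` is
concave on the first and convex on the last part of the remaining interval. On the middle part, of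
length `a₂`, it decreases by the bound for the derivative. So it changes sign only once. -/
theorem block_psi_two {a₁ a₂ : ℝ} (ha₁ : 0 ≤ a₁) (ha₂ : 0 ≤ a₂) {n : ℕ} {B : ℕ → ℝ}
    (hB : B n ≤ psi 2 a₁ a₂ (halfPeriod a₁ a₂)) (hB1 : a₂ = 0 ∨ B (n + 1) ≤ 1)
    (hB2 : B (n + 1 + 1) ≤ 1) (Y : ℕ → ℝ → ℝ) (hY : BoundedTower (n + 1) B Y) (u v : ℝ)
    (hu : 0 ≤ u) (huv : u < v) (hv : v < 0 + halfPeriod a₁ a₂)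
    (h : Y n u - psi 2 a₁ a₂ u < 0) : Y n v - psi 2 a₁ a₂ v ≤ 0 := by
  rw [zero_add] at hv
  have hT : halfPeriod a₁ a₂ = a₁ + a₂ + 2 := rfl
  set T := halfPeriod a₁ a₂
  let δ : ℝ → ℝ := fun t => Y n t - psi 2 a₁ a₂ t
  let g : ℝ → ℝ := fun t => Y (n + 1) t - psiOne a₁ a₂ t
  have hδ : ∀ t, HasDerivAt δ (g t) t := fun t =>
    (hY.hasDerivAt n (Nat.lt_succ_self n) t).sub (hasDerivAt_psi ha₁ ha₂ le_rfl t)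
  have mvt : ∀ p q, p < q → ∃ c, p < c ∧ c < q ∧ g c = (δ q - δ p) / (q - p) := by
    intro p q hpq
    obtain ⟨c, hc, hc'⟩ := exists_hasDerivAt_eq_slope δ g hpq
      (fun t _ => (hδ t).continuousAt.continuousWithinAt) (fun t _ => hδ t)
    exact ⟨c, hc.1, hc.2, hc'⟩
  have hYb := fun t => abs_le.1 (hY.bound n (Nat.le_succ n) t)
  have hψ0 := psi_two_halfPeriod ha₁ ha₂
  have hlow : ∀ t, 0 ≤ t → t ≤ a₁ → 0 ≤ δ t := by
    intro t h1 h2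
    simp only [δ]
    rw [psi_two_eq_of_le ha₁ ha₂ h1 h2]
    linarith [(hYb t).1]
  have hhigh : δ T ≤ 0 := by
    simp only [δ]
    linarith [(hYb T).2]
  have hlip : ∀ p q, p ≤ q → |Y (n + 1) q - Y (n + 1) p| ≤ q - p := by
    intro p q hpq
    refine (hY.lip q p).trans ?_
    rw [abs_of_nonneg (sub_nonneg.2 hpq)]
    nlinarith
  have hψ : ∀ t, 0 ≤ t → t ≤ T → psiOne a₁ a₂ t = min (max 0 (t - a₁)) (min 1 (T - t)) :=
    fun t h1 h2 => by rw [psiOne_eq_trapezoid ha₁ ha₂ h1 h2, trapezoid_eq_min ha₂]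
  have hg1 : ∀ p q, a₁ ≤ p → p ≤ q → q ≤ a₁ + 1 → g q ≤ g p := by
    intro p q hp hpq hq
    have e : ∀ t, a₁ ≤ t → t ≤ a₁ + 1 → psiOne a₁ a₂ t = t - a₁ := by
      intro t h1 h2
      rw [hψ t (by linarith) (by linarith), max_eq_right (by linarith),
        min_eq_left (le_min (by linarith) (by linarith))]
    simp only [g]
    rw [e p hp (by linarith), e q (by linarith) hq]
    linarith [(abs_le.1 (hlip p q hpq)).2]
  have hg3 : ∀ p q, a₁ + a₂ + 1 ≤ p → p ≤ q → q ≤ T → g p ≤ g q := by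
    intro p q hp hpq hq
    have e : ∀ t, a₁ + a₂ + 1 ≤ t → t ≤ T → psiOne a₁ a₂ t = T - t := by
      intro t h1 h2
      rw [hψ t (by linarith) (by linarith), max_eq_right (by linarith),
        min_eq_right (a := (1 : ℝ)) (by linarith), min_eq_right (by linarith)]
    simp only [g]
    rw [e p hp (by linarith), e q (by linarith) hq]
    linarith [(abs_le.1 (hlip p q hpq)).1]
  -- Once negative on the concave part, the difference decreases there.
  have step1 : ∀ p q, 0 ≤ p → p ≤ q → q ≤ a₁ + 1 → δ p < 0 → δ q ≤ 0 := by
    intro p q hp hpq hq hδp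
    rcases hpq.eq_or_lt with rfl | hpq
    · exact hδp.le
    have hpa : a₁ < p := by
      by_contra! hpa
      linarith [hlow p hp hpa]
    obtain ⟨c, hc1, hc2, hc⟩ := mvt a₁ p hpa
    obtain ⟨z, hz1, hz2, hz⟩ := mvt p q hpq
    have h1 : g c ≤ 0 := by
      rw [hc]
      exact div_nonpos_of_nonpos_of_nonneg (by linarith [hlow a₁ ha₁ le_rfl]) (by linarith)
    have h2 := hg1 c z hc1.le (by linarith) (by linarith)
    have h3 : δ q - δ p = g z * (q - p) := by
      rw [hz, div_mul_cancel₀ _ (by linarith)]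
    nlinarith
  have step2 : ∀ p q, a₁ + 1 ≤ p → p ≤ q → q ≤ a₁ + a₂ + 1 → δ p ≤ 0 → δ q ≤ 0 := by
    intro p q hp hpq hq hδp
    rcases hpq.eq_or_lt with rfl | hpq
    · exact hδp
    rcases hB1 with h0 | hB1
    · linarith
    obtain ⟨z, hz1, hz2, hz⟩ := mvt p q hpq
    have h2 : g z ≤ 0 := by
      simp only [g]
      rw [hψ z (by linarith) (by linarith), min_eq_left (a := (1 : ℝ)) (by linarith),
        max_eq_right (by linarith), min_eq_right (by linarith)]
      linarith [(abs_le.1 (hY.bound (n + 1) le_rfl z)).2]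
    have h3 : δ q - δ p = g z * (q - p) := by
      rw [hz, div_mul_cancel₀ _ (by linarith)]
    nlinarith
  have step3 : ∀ p q, a₁ + a₂ + 1 ≤ p → p ≤ q → q < T → δ p ≤ 0 → δ q ≤ 0 := by
    intro p q hp hpq hq hδp
    rcases hpq.eq_or_lt with rfl | hpq
    · exact hδp
    by_contra! hδq
    obtain ⟨c, hc1, hc2, hc⟩ := mvt p q hpq
    obtain ⟨z, hz1, hz2, hz⟩ := mvt q T hq
    have h1 : 0 < g c := by rw [hc]; exact div_pos (by linarith) (by linarith)
    have h2 : g z < 0 := by rw [hz]; exact div_neg_of_neg_of_pos (by linarith) (by linarith)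
    linarith [hg3 c z (by linarith) (by linarith) hz2.le]
  change δ v ≤ 0
  change δ u < 0 at h
  rcases le_total v (a₁ + 1) with hv1 | hv1
  · exact step1 u v hu huv.le hv1 h
  have s1 : δ (max u (a₁ + 1)) ≤ 0 := by
    rcases le_total u (a₁ + 1) with hu1 | hu1
    · rw [max_eq_right hu1]
      exact step1 u _ hu hu1 le_rfl h
    · rw [max_eq_left hu1]
      exact h.le
  have hm1 : max u (a₁ + 1) ≤ v := max_le huv.le hv1
  rcases le_total v (a₁ + a₂ + 1) with hv2 | hv2
  · exact step2 _ v (le_max_right _ _) hm1 hv2 s1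
  rcases le_total (max u (a₁ + 1)) (a₁ + a₂ + 1) with hm2 | hm2
  · exact step3 _ v le_rfl hv2 hv (step2 _ _ (le_max_right _ _) hm2 le_rfl s1)
  · exact step3 _ v hm2 hm1 hv s1

/-! ### The comparison theorem for the normalized spline -/

theorem abs_deriv_le_of_lipschitz {f : ℝ → ℝ} {C : ℝ} (hC : 0 ≤ C)
    (hf : ∀ u v, |f u - f v| ≤ C * |u - v|) (t : ℝ) : |deriv f t| ≤ C :=
  by
  simpa using norm_deriv_le_of_lip' (f := f) hC (Filter.Eventually.of_forall fun s => hf s t)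

/-- For `r = 1` the wave has slope `±1` except where it takes the values `±1`; there a function
bounded by `1` has a local extremum. -/
theorem abs_deriv_le_psiOne {a₂ : ℝ} (ha₂ : 0 ≤ a₂) {f : ℝ → ℝ} (hb : ∀ t, |f t| ≤ 1)
    (hL : ∀ u v, |f u - f v| ≤ 1 * |u - v|) {τ ξ : ℝ} (h : f τ = psiOne 0 a₂ ξ) :
    |deriv f τ| ≤ |deriv (psiOne 0 a₂) ξ| := by
  have hanti := psiOne_antiperiodic le_rfl ha₂
  have hT : halfPeriod 0 a₂ = a₂ + 2 := by unfold halfPeriod; ring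
  obtain ⟨j, h1, h2⟩ := exists_int_mul_mem_Ico (halfPeriod_pos le_rfl ha₂) (-1) ξ
  have hj := antiperiodic_add_int_mul hanti ξ j
  by_cases hw : -1 < ξ + j * halfPeriod 0 a₂ ∧ ξ + j * halfPeriod 0 a₂ < 1
  · have hf := abs_deriv_le_of_lipschitz zero_le_one hL τ
    have hloc : psiOne 0 a₂ =ᶠ[nhds ξ] fun s => (-1 : ℝ) ^ j * (s + j * halfPeriod 0 a₂) := by
      have hc : Continuous fun s : ℝ => s + j * halfPeriod 0 a₂ := by fun_prop
      filter_upwards [(isOpen_lt continuous_const hc).mem_nhds hw.1,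
        (isOpen_lt hc continuous_const).mem_nhds hw.2] with s hs1 hs2
      have hs := antiperiodic_add_int_mul hanti s j
      rw [psiOne_zero_left ha₂ (le_of_lt hs1) (le_of_lt hs2)] at hs
      rw [hs, ← mul_assoc, ← mul_zpow]
      simp
    have hd : HasDerivAt (fun s => (-1 : ℝ) ^ j * (s + j * halfPeriod 0 a₂)) ((-1 : ℝ) ^ j * 1) ξ :=
      ((hasDerivAt_id ξ).add_const _).const_mul _
    rw [hloc.deriv_eq, hd.deriv, abs_neg_one_zpow_mul, abs_one]
    exact hf
  · have habs : |f τ| = 1 := by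
      rw [h, ← abs_neg_one_zpow_mul j, ← hj]
      rcases h1.eq_or_lt with h1 | h1
      · rw [← h1, psiOne_zero_left ha₂ le_rfl (by norm_num), abs_neg, abs_one]
      · rw [psiOne_zero_left_plateau ha₂ (by by_contra! h3; exact hw ⟨h1, h3⟩) (by linarith),
          abs_one]
    have hz : deriv f τ = 0 := by
      rcases abs_eq zero_le_one |>.1 habs with he | he
      · exact IsLocalMax.deriv_eq_zero
          (Filter.Eventually.of_forall fun t => by rw [he]; exact (abs_le.1 (hb t)).2)
      · exact IsLocalMin.deriv_eq_zero
          (Filter.Eventually.of_forall fun t => by rw [he]; exact (abs_le.1 (hb t)).1)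
    rw [hz, abs_zero]
    exact abs_nonneg _

/-- `f` is bounded by every bound of `g`; this is `sup |f| ≤ sup |g|` for a bounded `g`. -/
def BoundedBy (f g : ℝ → ℝ) : Prop :=
  ∀ M, (∀ t, |g t| ≤ M) → ∀ t, |f t| ≤ M

/-- The comparison theorem for `ψ_{n+1}`, with pointwise bounds. The intermediate derivatives for
which no bound is given are bounded by unspecified constants. -/
theorem abs_deriv_le_psi {a₁ a₂ : ℝ} (ha₁ : 0 ≤ a₁) (ha₂ : 0 ≤ a₂) {n : ℕ} {X : ℕ → ℝ → ℝ}
    (hX : ∀ k < n, ∀ t, HasDerivAt (X k) (X (k + 1) t) t)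
    (hL : ∀ u v, |X n u - X n v| ≤ 1 * |u - v|) (h0 : BoundedBy (X 0) (psi (n + 1) a₁ a₂))
    (h : (a₁ = 0 ∧ BoundedBy (X n) (psi 1 a₁ a₂)) ∨
      ∃ m, n = m + 1 ∧ BoundedBy (X m) (psi 2 a₁ a₂) ∧
        (a₂ = 0 ∨ BoundedBy (X (m + 1)) (psi 1 a₁ a₂)))
    {τ ξ : ℝ} (hτξ : X 0 τ = psi (n + 1) a₁ a₂ ξ) :
    |deriv (X 0) τ| ≤ |deriv (psi (n + 1) a₁ a₂) ξ| := by
  rcases Nat.eq_zero_or_pos n with rfl | hn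
  · rcases h with ⟨rfl, hb⟩ | ⟨m, hm, -⟩
    · exact abs_deriv_le_psiOne ha₂ (hb 1 (abs_psiOne_le_one le_rfl ha₂)) hL hτξ
    · omega
  obtain ⟨M₀, hM₀, hMb, q, hq⟩ := exists_psi_min ha₁ ha₂ (show 1 ≤ n + 1 by omega)
  have hX0 := h0 M₀ hMb
  have hb : ∀ k, ∃ b > 0, k ≤ n → ∀ t, |X k t| ≤ b := by
    intro k
    by_cases hk : k ≤ n
    · obtain ⟨b, hb⟩ := exists_bound_of_lipschitz hX hX0 hL hk
      exact ⟨max b 1, by positivity, fun _ t => (hb t).trans (le_max_left _ _)⟩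
    · exact ⟨1, one_pos, fun h => absurd h hk⟩
  choose b hbpos hb using hb
  have hΦ : ∀ k < n, ∀ t,
      HasDerivAt (psi (n + 1 - k) a₁ a₂) (psi (n + 1 - (k + 1)) a₁ a₂ t) t := by
    intro k hk t
    obtain ⟨i, hi⟩ : ∃ i, n - k = i + 1 := ⟨n - k - 1, by omega⟩
    rw [show n + 1 - k = i + 1 + 1 by omega, show n + 1 - (k + 1) = i + 1 by omega]
    exact hasDerivAt_psi ha₁ ha₂ (by omega) t
  have hΦ1 := hΦ 0 hn ξ
  have hX1 := hX 0 hn τ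
  simp only [Nat.sub_zero, zero_add] at hΦ1 hX1
  rw [hX1.deriv, hΦ1.deriv]
  have main : ∀ (d : ℕ) (B : ℕ → ℝ), d ≤ n → BoundedTower n B X → (∀ k ≤ n + 1, 0 < B k) →
      B 0 = M₀ → (∀ Y, BoundedTower n B Y → ∀ s, ∃ o, ∀ j : ℤ, ∀ u v,
        o + j * halfPeriod a₁ a₂ ≤ u → u < v → v < o + (j + 1) * halfPeriod a₁ a₂ →
        (-1 : ℝ) ^ j * (Y d u - psi (n + 1 - d) a₁ a₂ (u + s)) < 0 →
        (-1 : ℝ) ^ j * (Y d v - psi (n + 1 - d) a₁ a₂ (v + s)) ≤ 0) →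
      |X 1 τ| ≤ |psi (n + 1 - 1) a₁ a₂ ξ| := by
    intro d B hd hXB hB hB0 hsign
    have hC : ComparisonTower n d B (fun k => psi (n + 1 - k) a₁ a₂) (halfPeriod a₁ a₂) q :=
      { one_le := hn
        le := hd
        pos := halfPeriod_pos ha₁ ha₂
        bound_pos := hB
        hasDerivAt := hΦ
        antiperiodic := psi_antiperiodic ha₁ ha₂ (by omega)
        bound := fun t => by rw [hB0]; exact hMb t
        min_eq := by rw [hB0]; exact hq
        sign_change := hsign }
    exact hC.abs_le hXB hτξ
  rcases h with ⟨rfl, hXn⟩ | ⟨m, rfl, hXm, hXm1⟩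
  · -- The `(r - 1)`-th derivatives are compared.
    let B : ℕ → ℝ := fun k => if n ≤ k then 1 else if k = 0 then M₀ else b k
    refine main n B le_rfl ⟨hX, ?_, ?_⟩ ?_ ?_ ?_
    · intro k hk t
      simp only [B]
      split_ifs with h1 h2
      · obtain rfl : k = n := le_antisymm hk h1
        exact hXn 1 (abs_psiOne_le_one le_rfl ha₂) t
      · rw [h2]; exact hX0 t
      · exact hb k hk t
    · simpa [B] using hL
    · intro k _
      simp only [B]
      split_ifs
      exacts [one_pos, hM₀, hbpos k]
    · simp [B, hn.ne']
    · rw [Nat.add_sub_cancel_left]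
      exact sign_change_of_block (psi_antiperiodic le_rfl ha₂ le_rfl)
        (block_psiOne ha₂ (by simp [B]) (by simp [B]))
  · -- The `(r - 2)`-th derivatives are compared.
    have hM2 : 0 < psi 2 a₁ a₂ (halfPeriod a₁ a₂) := by
      obtain ⟨t, ht⟩ := exists_psi_ne_zero ha₁ ha₂ one_le_two
      exact (abs_pos.2 ht).trans_le (abs_psi_two_le ha₁ ha₂ t)
    let B : ℕ → ℝ := fun k => if k = m + 2 then 1 else if k = 0 then M₀ else if k = m then
      psi 2 a₁ a₂ (halfPeriod a₁ a₂) else if k = m + 1 ∧ a₂ ≠ 0 then 1 else b k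
    refine main m B (Nat.le_succ m) ⟨hX, ?_, ?_⟩ ?_ ?_ ?_
    · intro k hk t
      simp only [B]
      split_ifs with h1 h2 h3 h4
      · omega
      · rw [h2]; exact hX0 t
      · rw [h3]; exact hXm _ (abs_psi_two_le ha₁ ha₂) t
      · rw [h4.1]
        exact hXm1.resolve_left h4.2 1 (abs_psiOne_le_one ha₁ ha₂) t
      · exact hb k hk t
    · simpa [B] using hL
    · intro k _
      simp only [B]
      split_ifs
      exacts [one_pos, hM₀, hM2, one_pos, hbpos k]
    · simp [B]
    · rw [show m + 1 + 1 - m = 2 by omega]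
      refine sign_change_of_block (o := 0) (psi_antiperiodic ha₁ ha₂ one_le_two)
        (block_psi_two ha₁ ha₂ ?_ ?_ (by simp [B]))
      · rcases Nat.eq_zero_or_pos m with rfl | hm
        · have := abs_psi_two_le ha₁ ha₂ q
          rw [show (2 : ℕ) = 0 + 1 + 1 from rfl, hq, abs_neg, abs_of_pos hM₀] at this
          simpa [B] using this
        · simp [B, hm.ne']
      · by_cases h2 : a₂ = 0
        · exact Or.inl h2
        · right
          simp [B, h2]

/-! ### Essential suprema and scaling -/

theorem ae_abs_le_of_derivNormLE {k : ℕ} {x y : ℝ → ℝ} {M : ℝ} (h : DerivNormLE k x y)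
    (hM : ∀ t, |iteratedDeriv k y t| ≤ M) : ∀ᵐ t, |iteratedDeriv k x t| ≤ M := by
  have hM0 : 0 ≤ M := (abs_nonneg _).trans (hM 0)
  unfold DerivNormLE supNorm at h
  rw [eLpNorm_exponent_top, eLpNorm_exponent_top] at h
  have h1 : eLpNormEssSup (iteratedDeriv k y) volume ≤ ENNReal.ofReal M :=
    eLpNormEssSup_le_of_ae_bound (Filter.Eventually.of_forall hM)
  filter_upwards [ae_le_eLpNormEssSup (f := iteratedDeriv k x) (μ := volume)] with t ht
  have h2 := ht.trans (h.trans h1)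
  rw [← ofReal_norm, ENNReal.ofReal_le_ofReal_iff hM0] at h2
  exact h2

theorem abs_le_of_ae_abs_le {f : ℝ → ℝ} (hf : Continuous f) {M : ℝ} (h : ∀ᵐ t, |f t| ≤ M) (t : ℝ) :
    |f t| ≤ M := by
  have ho : IsOpen {t | M < |f t|} := isOpen_lt continuous_const hf.abs
  have hz : volume {t | M < |f t|} = 0 := by
    rw [ae_iff] at h
    simpa using h
  by_contra! ht
  have := ho.eq_empty_of_measure_zero hz
  exact (this ▸ (show t ∈ {t | M < |f t|} from ht) : t ∈ (∅ : Set ℝ)).elim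

theorem abs_sub_le_of_absolutelyContinuous {f : ℝ → ℝ} {C : ℝ}
    (hf : ∀ u v, AbsolutelyContinuousOnInterval f u v) (hC : ∀ᵐ t, |deriv f t| ≤ C) (u v : ℝ) :
    |f u - f v| ≤ C * |u - v| := by
  rw [← (hf v u).integral_deriv_eq_sub]
  exact intervalIntegral.norm_integral_le_of_norm_le_const_ae (f := deriv f) (hC.mono fun t ht _ => ht)

section Spline

variable {a₁ a₂ b l : ℝ} {r : ℕ}

theorem iteratedDeriv_comparisonSpline (ha₁ : 0 ≤ a₁) (ha₂ : 0 ≤ a₂) (hl : 0 < l) {k : ℕ}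
    (hk : k < r) : iteratedDeriv k (comparisonSpline r a₁ a₂ b l) = fun t =>
      b * (l / (2 * a₁ + 2 * a₂ + 4)) ^ (r - k) *
        psi (r - k) a₁ a₂ ((2 * a₁ + 2 * a₂ + 4) / l * t) := by
  have hp : 0 < 2 * a₁ + 2 * a₂ + 4 := by linarith
  induction k with
  | zero => rfl
  | succ k ih =>
    rw [iteratedDeriv_succ, ih (by omega)]
    funext t
    obtain ⟨i, hi⟩ : ∃ i, r - k = i + 1 + 1 := ⟨r - k - 2, by omega⟩
    rw [hi, show r - (k + 1) = i + 1 by omega]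
    have h1 := ((hasDerivAt_psi (r := i + 1) ha₁ ha₂ (by omega)
      ((2 * a₁ + 2 * a₂ + 4) / l * t)).comp t ((hasDerivAt_id t).const_mul
        ((2 * a₁ + 2 * a₂ + 4) / l))).const_mul (b * (l / (2 * a₁ + 2 * a₂ + 4)) ^ (i + 1 + 1))
    refine h1.deriv.trans ?_
    rw [pow_succ _ (i + 1)]
    field_simp

/-- The bound holds at every point, since the derivative that does not exist is `0`. -/
theorem abs_iteratedDeriv_comparisonSpline_le (ha₁ : 0 ≤ a₁) (ha₂ : 0 ≤ a₂) (hl : 0 < l)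
    (hr : 1 ≤ r) (t : ℝ) : |iteratedDeriv r (comparisonSpline r a₁ a₂ b l) t| ≤ |b| := by
  have hp : 0 < 2 * a₁ + 2 * a₂ + 4 := by linarith
  obtain ⟨n, rfl⟩ : ∃ n, r = n + 1 := ⟨r - 1, by omega⟩
  rw [iteratedDeriv_succ, iteratedDeriv_comparisonSpline ha₁ ha₂ hl n.lt_add_one,
    Nat.add_sub_cancel_left, pow_one]
  refine abs_deriv_le_of_lipschitz (abs_nonneg b) (fun u v => ?_) t
  rw [← mul_sub, abs_mul, abs_mul, mul_assoc]
  refine mul_le_mul_of_nonneg_left ?_ (abs_nonneg b)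
  have h1 := abs_psiOne_sub_le ha₁ ha₂ ((2 * a₁ + 2 * a₂ + 4) / l * u)
    ((2 * a₁ + 2 * a₂ + 4) / l * v)
  rw [one_mul, ← mul_sub, abs_mul, abs_of_pos (div_pos hp hl)] at h1
  rw [abs_of_pos (div_pos hl hp)]
  refine (mul_le_mul_of_nonneg_left h1 (div_pos hl hp).le).trans_eq ?_
  field_simp

end Spline

end RodovComparison

theorem mainTheorem1
    (r : ℕ) (hr : 1 ≤ r)
    (x : ℝ → ℝ) (hx : RodovComparison.MemLInfInf r x)
    (a₁ a₂ b l : ℝ) (ha₁ : 0 ≤ a₁) (ha₂ : 0 ≤ a₂) (hl : 0 < l) (hb : b ≠ 0)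
    (h :
      (a₁ = 0 ∧ ∀ k ∈ ({0, r - 1, r} : Set ℕ),
        RodovComparison.DerivNormLE k x (RodovComparison.comparisonSpline r a₁ a₂ b l)) ∨
      (2 ≤ r ∧ a₂ = 0 ∧ ∀ k ∈ ({0, r - 2, r} : Set ℕ),
        RodovComparison.DerivNormLE k x (RodovComparison.comparisonSpline r a₁ a₂ b l)) ∨
      (2 ≤ r ∧ ∀ k ∈ ({0, r - 1, r - 2, r} : Set ℕ),
        RodovComparison.DerivNormLE k x (RodovComparison.comparisonSpline r a₁ a₂ b l)))
    (τ ξ : ℝ) (hτξ : x τ = RodovComparison.comparisonSpline r a₁ a₂ b l ξ) :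
    |deriv x τ| ≤ |deriv (RodovComparison.comparisonSpline r a₁ a₂ b l) ξ| := by
  open RodovComparison in
  have hp : 0 < 2 * a₁ + 2 * a₂ + 4 := by linarith
  obtain ⟨n, rfl⟩ : ∃ n, r = n + 1 := ⟨r - 1, by omega⟩
  have hspline : comparisonSpline (n + 1) a₁ a₂ b l = fun t =>
      b * (l / (2 * a₁ + 2 * a₂ + 4)) ^ (n + 1) *
        psi (n + 1) a₁ a₂ ((2 * a₁ + 2 * a₂ + 4) / l * t) := rfl
  -- The hypotheses that all three cases share.
  have h0 : DerivNormLE 0 x (comparisonSpline (n + 1) a₁ a₂ b l) := by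
    rcases h with h | h | h
    exacts [h.2 0 (by simp), h.2.2 0 (by simp), h.2 0 (by simp)]
  have htop : DerivNormLE (n + 1) x (comparisonSpline (n + 1) a₁ a₂ b l) := by
    rcases h with h | h | h
    exacts [h.2 _ (by simp), h.2.2 _ (by simp), h.2 _ (by simp)]
  obtain ⟨c, hc⟩ : ∃ c, c = l / (2 * a₁ + 2 * a₂ + 4) := ⟨_, rfl⟩
  have hcinv : (2 * a₁ + 2 * a₂ + 4) / l = c⁻¹ := by rw [hc, inv_div]
  have hcpos : 0 < c := by rw [hc]; positivity
  have hdiff : ∀ k < n, ∀ t, HasDerivAt (iteratedDeriv k x) (iteratedDeriv (k + 1) x t) t := by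
    intro k hk t
    rw [iteratedDeriv_succ]
    exact ((hx.contDiff.differentiable_iteratedDeriv k
      (by exact_mod_cast (by omega : k < n + 1 - 1))) t).hasDerivAt
  have hcont : ∀ k ≤ n, Continuous (iteratedDeriv k x) := fun k hk =>
    hx.contDiff.continuous_iteratedDeriv k (by exact_mod_cast (by omega : k ≤ n + 1 - 1))
  have hlip : ∀ u v, |iteratedDeriv n x u - iteratedDeriv n x v| ≤ |b| * |u - v| := by
    refine abs_sub_le_of_absolutelyContinuous hx.locallyAC ?_
    have := ae_abs_le_of_derivNormLE htop
      (abs_iteratedDeriv_comparisonSpline_le ha₁ ha₂ hl (by omega))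
    rwa [iteratedDeriv_succ] at this
  -- The normalized function: it is compared with `ψ_{n+1}` itself.
  let X : ℕ → ℝ → ℝ := fun k s => (b * c ^ (n + 1))⁻¹ * (c ^ k * iteratedDeriv k x (c * s))
  have hXd : ∀ k < n, ∀ t, HasDerivAt (X k) (X (k + 1) t) t := by
    intro k hk t
    have h1 := (((hdiff k hk (c * t)).comp t ((hasDerivAt_id t).const_mul c)).const_mul
      (c ^ k)).const_mul (b * c ^ (n + 1))⁻¹
    refine h1.congr_deriv ?_
    simp only [X]
    ring
  have hXL : ∀ u v, |X n u - X n v| ≤ 1 * |u - v| := by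
    intro u v
    have h1 := hlip (c * u) (c * v)
    rw [← mul_sub, abs_mul c, abs_of_pos hcpos] at h1
    simp only [X]
    rw [← mul_sub, ← mul_sub, abs_mul, abs_mul, abs_inv, abs_mul, abs_of_pos (pow_pos hcpos _),
      abs_of_pos (pow_pos hcpos _), inv_mul_le_iff₀ (by positivity)]
    refine (mul_le_mul_of_nonneg_left h1 (pow_pos hcpos n).le).trans_eq ?_
    ring
  have hXb : ∀ k ≤ n, DerivNormLE k x (comparisonSpline (n + 1) a₁ a₂ b l) →
      BoundedBy (X k) (psi (n + 1 - k) a₁ a₂) := by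
    intro k hk hle M hM t
    have h1 : ∀ s, |iteratedDeriv k x s| ≤ |b| * c ^ (n + 1 - k) * M := by
      refine abs_le_of_ae_abs_le (hcont k hk) (ae_abs_le_of_derivNormLE hle fun s => ?_)
      rw [iteratedDeriv_comparisonSpline ha₁ ha₂ hl (by omega), ← hc, abs_mul, abs_mul,
        abs_of_pos (pow_pos hcpos _)]
      exact mul_le_mul_of_nonneg_left (hM _) (by positivity)
    simp only [X]
    rw [abs_mul, abs_mul, abs_inv, abs_mul, abs_of_pos (pow_pos hcpos _),
      abs_of_pos (pow_pos hcpos _), inv_mul_le_iff₀ (by positivity)]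
    refine (mul_le_mul_of_nonneg_left (h1 (c * t)) (pow_pos hcpos k).le).trans_eq ?_
    have e : c ^ (n + 1) = c ^ k * c ^ (n + 1 - k) := by
      rw [← pow_add]
      congr 1
      omega
    rw [e]
    ring
  have hbc : b * c ^ (n + 1) ≠ 0 := by positivity
  have hxX : x = fun t => b * c ^ (n + 1) * X 0 (c⁻¹ * t) := by
    funext t
    simp only [X, pow_zero, one_mul, iteratedDeriv_zero]
    rw [mul_inv_cancel_left₀ hbc, mul_inv_cancel_left₀ hcpos.ne']
  have hval : X 0 (c⁻¹ * τ) = psi (n + 1) a₁ a₂ (c⁻¹ * ξ) := by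
    rw [hspline, hxX, hcinv, ← hc] at hτξ
    exact mul_left_cancel₀ hbc hτξ
  have key : |deriv (X 0) (c⁻¹ * τ)| ≤ |deriv (psi (n + 1) a₁ a₂) (c⁻¹ * ξ)| := by
    refine abs_deriv_le_psi ha₁ ha₂ hXd hXL (hXb 0 (Nat.zero_le _) h0) ?_ hval
    rcases h with ⟨h1, h2⟩ | ⟨h1, h2, h3⟩ | ⟨h1, h2⟩
    · left
      refine ⟨h1, ?_⟩
      have := hXb n le_rfl (h2 n (by simp))
      rwa [Nat.add_sub_cancel_left] at this
    · right
      obtain ⟨m, rfl⟩ : ∃ m, n = m + 1 := ⟨n - 1, by omega⟩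
      refine ⟨m, rfl, ?_, Or.inl h2⟩
      have := hXb m (Nat.le_succ m) (h3 m (by simp))
      rwa [show m + 1 + 1 - m = 2 by omega] at this
    · right
      obtain ⟨m, rfl⟩ : ∃ m, n = m + 1 := ⟨n - 1, by omega⟩
      refine ⟨m, rfl, ?_, Or.inr ?_⟩
      · have := hXb m (Nat.le_succ m) (h2 m (by simp))
        rwa [show m + 1 + 1 - m = 2 by omega] at this
      · have := hXb (m + 1) le_rfl (h2 (m + 1) (by simp))
        rwa [Nat.add_sub_cancel_left] at this
  have hscale : ∀ (f : ℝ → ℝ) s, deriv (fun t => b * c ^ (n + 1) * f (c⁻¹ * t)) s =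
      b * c ^ (n + 1) * (c⁻¹ * deriv f (c⁻¹ * s)) := by
    intro f s
    rw [deriv_const_mul_field, deriv_comp_mul_left, smul_eq_mul]
  rw [hspline, hcinv, ← hc, hxX, hscale, hscale, abs_mul, abs_mul c⁻¹,
    abs_mul (b * c ^ (n + 1)), abs_mul c⁻¹]
  gcongr
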